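/- Let $1\le d\le 3$, $2\le p<\infty$, $\gamma_+,\gamma_->0$, $t_+\in(0,1)$, and let $\gamma:\mathbb R\to\mathbb R$ be the $1$-periodic function with $\gamma(t)=\gamma_+$ for $0<t\le t_+$ and $\gamma(t)=-\gamma_-$ for $t_+<t\le 1$. For $\varepsilon>0$, $t_0\in\mathbb R$ and $\varphi\in H^2(\mathbb R^d)$ consider $$ i\partial_t u_\varepsilon+\gamma\!\left(\tfrac t\varepsilon\right)\Delta u_\varepsilon+|u_\varepsilon|^{p-1}u_\varepsilon=0,\qquad u_\varepsilon(t_0,\cdot)=\varphi. \tag{1}$$ A solution of (1) on $[t_0,T]$ is a function $u\in C([t_0,T],H^2(\mathbb R^d))$ with $u(t_0)=\varphi$ that, at every $t\in(t_0,T)$ at which $\gamma(\cdot/\varepsilon)$ does not jump, is differentiable in time with values in $L^2(\mathbb R^d)$ and satisfies the equation in $L^2(\mathbb R^d)$. Let $T^*=T^*(\varphi,t_0,\varepsilon)\in[-\infty,+\infty]$ be the supremum of all $T>t_0$ for which (1) has a solution on $[t_0,T]$. Then: 1. For all $\varepsilon>0$, $t_0\in\mathbb R$ and $\varphi\in H^2(\mathbb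 R^d)$ we have $T^*>t_0$, and there is a function $u_\varepsilon:[t_0,T^*)\to H^2(\mathbb R^d)$ which, for every $t_0<T<T^*$, is a solution of (1) on $[t_0,T]$, and the only one. If $T^*<+\infty$, then $\lim_{t\to T^*,\,t<T^*}\|u_\varepsilon(t,\cdot)\|_{H^2(\mathbb R^d)}=+\infty$. 2. The existence time is bounded below in terms of $\varepsilon$ and the norm of $\varphi$ only: for all $\varepsilon>0$ and $M\in\mathbb R$ there is $\delta>0$ such that $T^*(\varphi,t_0,\varepsilon)\ge t_0+\delta$ for all $t_0\in\mathbb R$ and all $\varphi\in H^2(\mathbb R^d)$ with $\|\varphi\|_{H^2}\le M$. 3. This bound is uniform in $\varepsilon\in(0,1]$: for every $M\in\mathbb R$ there is $\delta>0$ such that $T^*(\varphi,t_0,\varepsilon)\ge t_0+\delta$ for all $\varepsilon\in(0,1]$, all $t_0\in\mathbb R$ and all $\varphi\in H^2(\mathbb R^d)$ with $\|\varphi\|_{H^2}\le M$. In particular $\inf_{0<\varepsilon\le1}T^*(\varphi,t_0,\varepsilon)>t_0$. In 2 and 3, $\delta$ may also depend on the fixed data $d$, $p$, $\gamma_\pm$,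 $t_+$. -/

import Mathlib

open MeasureTheory Filter Topology Set
open scoped Laplacian SchwartzMap

noncomputable section

namespace DispersionNLS

/-- The complex space `L²(ℝᵈ)`. -/
abbrev L2Space (d : ℕ) : Type :=
  Lp ℂ 2 (volume : Measure (EuclideanSpace ℝ (Fin d)))

/-- The tempered distribution given by an `L²` function. -/
abbrev toDistr {d : ℕ} : L2Space d →L[ℂ] 𝓢'(EuclideanSpace ℝ (Fin d), ℂ) :=
  Lp.toTemperedDistributionCLM ℂ volume 2

theorem toDistr_injective {d : ℕ} : Function.Injective (toDistr (d := d)) :=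
  LinearMap.ker_eq_bot.mp (Lp.ker_toTemperedDistributionCLM_eq_bot (F := ℂ) (p := 2))

/-- The functions of `L²(ℝᵈ)` that lie in the Sobolev space `H²(ℝᵈ)`. -/
def sobolevSubmodule (d : ℕ) : Submodule ℂ (L2Space d) where
  carrier := {f | TemperedDistribution.MemSobolev 2 2 (toDistr f)}
  add_mem' {f g} hf hg := by
    have h := TemperedDistribution.MemSobolev.add hf hg
    rwa [← map_add] at h
  zero_mem' := by
    have h := TemperedDistribution.memSobolev_fun_zero
      (EuclideanSpace ℝ (Fin d)) ℂ 2 (p := 2)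
    rwa [← map_zero (toDistr (d := d))] at h
  smul_mem' c f hf := by
    have h := TemperedDistribution.MemSobolev.smul c hf
    rwa [← map_smul] at h

/-- The Sobolev space `H²(ℝᵈ)`, as a type of its own: it carries the `H²` norm defined below and
not the `L²` norm of the submodule. -/
def H2Space (d : ℕ) : Type := sobolevSubmodule d

instance (d : ℕ) : AddCommGroup (H2Space d) :=
  inferInstanceAs (AddCommGroup (sobolevSubmodule d))

instance (d : ℕ) : Module ℂ (H2Space d) :=
  inferInstanceAs (Module ℂ (sobolevSubmodule d))

/-- The inclusion of `H²(ℝᵈ)` into `L²(ℝᵈ)`. -/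
def toL2 {d : ℕ} : H2Space d →ₗ[ℂ] L2Space d := (sobolevSubmodule d).subtype

theorem toL2_injective {d : ℕ} : Function.Injective (toL2 (d := d)) := Subtype.val_injective

/-- An `L²` function in the Sobolev space, as an element of `H²(ℝᵈ)`. -/
def H2Space.mk {d : ℕ} (f : L2Space d)
    (hf : TemperedDistribution.MemSobolev 2 2 (toDistr f)) : H2Space d := ⟨f, hf⟩

theorem toL2_mk {d : ℕ} (f : L2Space d)
    (hf : TemperedDistribution.MemSobolev 2 2 (toDistr f)) : toL2 (H2Space.mk f hf) = f := rfl

theorem memSobolev_toL2 {d : ℕ} (f : H2Space d) :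
    TemperedDistribution.MemSobolev 2 2 (toDistr (toL2 f)) := f.2

/-- The Bessel potential `𝓕⁻¹ (1 + |ξ|²) 𝓕 f` of `f ∈ H²`, an element of `L²`. -/
def besselFun {d : ℕ} (f : H2Space d) : L2Space d := (memSobolev_toL2 f).choose

theorem toDistr_besselFun {d : ℕ} (f : H2Space d) :
    toDistr (besselFun f) =
      TemperedDistribution.besselPotential (EuclideanSpace ℝ (Fin d)) ℂ 2 (toDistr (toL2 f)) :=
  (memSobolev_toL2 f).choose_spec.symm

/-- `besselFun` as a linear map. -/
def bessel {d : ℕ} : H2Space d →ₗ[ℂ] L2Space d where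
  toFun := besselFun
  map_add' f g := toDistr_injective (by simp only [toDistr_besselFun, map_add])
  map_smul' c f := toDistr_injective (by
    simp only [toDistr_besselFun, map_smul, RingHom.id_apply])

theorem bessel_injective {d : ℕ} : Function.Injective (bessel (d := d)) := by
  intro f g h
  have h' := congrArg toDistr h
  change toDistr (besselFun f) = toDistr (besselFun g) at h'
  rw [toDistr_besselFun, toDistr_besselFun] at h'
  apply toL2_injective
  apply toDistr_injective
  rw [← TemperedDistribution.besselPotential_neg_apply_eq_iff,
    (TemperedDistribution.besselPotential_neg_apply_eq_iff 2 _ _).mpr rfl] at h'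
  exact h'.symm

/-- The `H²` norm `‖f‖ = ‖𝓕⁻¹ (1 + |ξ|²) 𝓕 f‖_{L²}`. -/
instance (d : ℕ) : NormedAddCommGroup (H2Space d) :=
  NormedAddCommGroup.induced (H2Space d) (L2Space d) bessel bessel_injective

instance (d : ℕ) : NormedSpace ℂ (H2Space d) :=
  NormedSpace.induced ℂ (H2Space d) (L2Space d) bessel

theorem exists_laplacian {d : ℕ} (f : H2Space d) :
    ∃ g : L2Space d, toDistr g = Δ (toDistr (toL2 f)) := by
  have h := (memSobolev_toL2 f).laplacian
  rw [sub_self, TemperedDistribution.memSobolev_zero_iff] at h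
  obtain ⟨g, hg⟩ := h
  exact ⟨g, hg.symm⟩

/-- The Laplacian `Δ f ∈ L²` of `f ∈ H²`, in the sense of distributions. -/
def laplace {d : ℕ} (f : H2Space d) : L2Space d := (exists_laplacian f).choose

theorem toDistr_laplace {d : ℕ} (f : H2Space d) :
    toDistr (laplace f) = Δ (toDistr (toL2 f)) := (exists_laplacian f).choose_spec

/-- The `1`-periodic dispersion map: `γ₊` on `(n, n + t₊]` and `-γ₋` on `(n + t₊, n + 1]` for
every integer `n`. -/
def dispersionMap (γp γm tp t : ℝ) : ℝ :=
  if 0 < Int.fract t ∧ Int.fract t ≤ tp then γp else -γm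

/-- `u ∈ C([t₀, T]; H²)` solves `i ∂ₜu + γ(t/ε) Δu + |u|^{p-1} u = 0`, `u(t₀) = φ`: the equation
holds in `L²`, with the strong time derivative in `L²`, at every time of `(t₀, T)` at which
`γ(·/ε)` does not jump. -/
structure IsSolutionOn {d : ℕ} (p γp γm tp ε t₀ : ℝ) (φ : H2Space d) (T : ℝ)
    (u : ℝ → H2Space d) : Prop where
  continuousOn : ContinuousOn u (Icc t₀ T)
  initial : u t₀ = φ
  equation : ∀ t ∈ Ioo t₀ T, ContinuousAt (fun s => dispersionMap γp γm tp (s / ε)) t →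
    ∃ u' : L2Space d, HasDerivAt (fun s => toL2 (u s)) u' t ∧
      ∀ᵐ x : EuclideanSpace ℝ (Fin d),
        Complex.I * u' x + (dispersionMap γp γm tp (t / ε) : ℂ) * laplace (u t) x
          + ((‖toL2 (u t) x‖ ^ (p - 1) : ℝ) : ℂ) * toL2 (u t) x = 0

/-- The maximal time of existence `T*`: the supremum, in the extended reals, of all `T > t₀` for
which a solution in `C([t₀, T]; H²)` exists. -/
def maxTime {d : ℕ} (p γp γm tp ε t₀ : ℝ) (φ : H2Space d) : EReal :=
  sSup {τ : EReal | ∃ T : ℝ, τ = T ∧ t₀ < T ∧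
    ∃ u : ℝ → H2Space d, IsSolutionOn p γp γm tp ε t₀ φ T u}

end DispersionNLS

/-!
Let `a` be a primitive of `γ(·/ε)`; whatever `γ` and `ε` are, `a` is continuous. In the interaction
picture `z = e^{-i a(t) Δ} u` the dispersive term disappears and the equation becomes
`z' = i e^{-i a(t) Δ} N(e^{i a(t) Δ} z)` with `N(u) = |u|^{p-1} u`, where the propagators are
isometries of `L²` and of `H²`. For `d ≤ 3` the embedding `H² ⊆ L^∞` makes `N` Lipschitz for the
`L²` norm on balls of `H²`. It also maps balls of `H²` into balls of `H²`: a function is in `H²` as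
soon as its second differences `f(· + h) + f(· - h) - 2f` are `O(|h|²)` in `L²`, and those of `N(u)`
are controlled by the second differences of `u` and the square of the first ones, which is estimated
in `L⁴` by interpolation between `L^∞` and `H²`. Balls of `H²` are closed in `L²`, so Picard
iteration in an `H²` ball with the `L²` distance gives a solution on a time interval whose length
depends on `d`, `p` and the `H²` norm of the datum only, hence not on `ε`.
-/

noncomputable section

namespace DispersionNLS

open scoped ENNReal NNReal FourierTransform RealInnerProductSpace BoundedContinuousFunction

section Rpow

variable {q M x y : ℝ}

theorem rpow_sub_rpow_le (hq : 1 ≤ q) (hx : 0 ≤ x) (hy : 0 ≤ y) :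
    y ^ q - x ^ q ≤ q * y ^ (q - 1) * (y - x) := by
  rcases hy.eq_or_lt with rfl | hy
  · rcases hq.eq_or_lt with rfl | hq
    · simp
    · rw [Real.zero_rpow (by linarith), Real.zero_rpow (by linarith)]
      linarith [Real.rpow_nonneg hx q]
  · have bernoulli := one_add_mul_self_le_rpow_one_add (s := x / y - 1)
      (by linarith [div_nonneg hx hy.le]) hq
    rw [add_sub_cancel, Real.div_rpow hx hy.le, le_div_iff₀ (by positivity)] at bernoulli
    have hyq : y ^ q = y ^ (q - 1) * y := by rw [← Real.rpow_add_one hy.ne', sub_add_cancel]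
    have : (1 + q * (x / y - 1)) * y ^ q = y ^ q - q * y ^ (q - 1) * (y - x) := by
      rw [hyq]; field_simp; ring
    linarith

theorem abs_rpow_sub_rpow_le (hq : 1 ≤ q) (hx : 0 ≤ x) (hy : 0 ≤ y) (hxM : x ≤ M) (hyM : y ≤ M) :
    |y ^ q - x ^ q| ≤ q * M ^ (q - 1) * |y - x| := by
  wlog hxy : x ≤ y generalizing x y
  · rw [abs_sub_comm, abs_sub_comm y]
    exact this hy hx hyM hxM (le_of_not_ge hxy)
  rw [abs_of_nonneg (sub_nonneg.2 (Real.rpow_le_rpow hx hxy (by linarith))),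
    abs_of_nonneg (sub_nonneg.2 hxy)]
  refine (rpow_sub_rpow_le hq hx hy).trans ?_
  have := sub_nonneg.2 hxy
  have := Real.rpow_le_rpow hy hyM (sub_nonneg.2 hq)
  gcongr

theorem mul_abs_rpow_sub_rpow_le (hq : 0 ≤ q) (hx : 0 ≤ x) (hy : 0 ≤ y) (hxM : x ≤ M)
    (hyM : y ≤ M) : x * |y ^ q - x ^ q| ≤ (q + 2) * M ^ q * |y - x| := by
  have key := abs_rpow_sub_rpow_le (q := q + 1) (by linarith) hx hy hxM hyM
  rw [add_sub_cancel_right, Real.rpow_add_one' hx (by linarith),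
    Real.rpow_add_one' hy (by linarith)] at key
  calc x * |y ^ q - x ^ q| = |(y ^ q * y - x ^ q * x) - y ^ q * (y - x)| := by
        rw [← abs_of_nonneg hx, ← abs_mul, abs_of_nonneg hx]; congr 1; ring
    _ ≤ |y ^ q * y - x ^ q * x| + |y ^ q * (y - x)| := abs_sub _ _
    _ = |y ^ q * y - x ^ q * x| + y ^ q * |y - x| := by
        rw [abs_mul, abs_of_nonneg (Real.rpow_nonneg hy q)]
    _ ≤ (q + 1) * M ^ q * |y - x| + M ^ q * |y - x| := by gcongr
    _ = (q + 2) * M ^ q * |y - x| := by ring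

theorem mul_rpow_sub_tangent_le (hq : 1 ≤ q) (hx : 0 ≤ x) (hy : 0 ≤ y) (hxM : x ≤ M)
    (hyM : y ≤ M) :
    x * (y ^ q - x ^ q - q * x ^ (q - 1) * (y - x)) ≤
      q * (q + 1) * M ^ (q - 1) * (y - x) ^ 2 := by
  have hlip : x * |y ^ (q - 1) - x ^ (q - 1)| ≤ (q + 1) * M ^ (q - 1) * |y - x| := by
    have := mul_abs_rpow_sub_rpow_le (sub_nonneg.2 hq) hx hy hxM hyM
    rwa [show q - 1 + 2 = q + 1 by ring] at this
  calc x * (y ^ q - x ^ q - q * x ^ (q - 1) * (y - x))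
      ≤ x * (q * y ^ (q - 1) * (y - x) - q * x ^ (q - 1) * (y - x)) := by
        have := rpow_sub_rpow_le hq hx hy
        gcongr
    _ = q * (x * ((y ^ (q - 1) - x ^ (q - 1)) * (y - x))) := by ring
    _ ≤ q * (x * (|y ^ (q - 1) - x ^ (q - 1)| * |y - x|)) := by
        rw [← abs_mul]; gcongr; exact le_abs_self _
    _ = q * (x * |y ^ (q - 1) - x ^ (q - 1)| * |y - x|) := by ring
    _ ≤ q * ((q + 1) * M ^ (q - 1) * |y - x| * |y - x|) := by gcongr
    _ = q * (q + 1) * M ^ (q - 1) * (y - x) ^ 2 := by rw [← sq_abs (y - x)]; ring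

end Rpow

section PowerNonlinearity

variable {F : Type*} [NormedAddCommGroup F]

/-- The power nonlinearity `|z|^q z`. -/
def powNL [NormedSpace ℝ F] (q : ℝ) (z : F) : F := ‖z‖ ^ q • z

section Normed

variable [NormedSpace ℝ F] {q M : ℝ}

theorem norm_powNL_sub_le (hq : 1 ≤ q) {a b : F} (ha : ‖a‖ ≤ M) (hb : ‖b‖ ≤ M) :
    ‖powNL q a - powNL q b‖ ≤ (q + 1) * M ^ q * ‖a - b‖ := by
  have hM : 0 ≤ M := (norm_nonneg a).trans ha
  have hpow : |‖a‖ ^ q - ‖b‖ ^ q| ≤ q * M ^ (q - 1) * ‖a - b‖ :=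
    (abs_rpow_sub_rpow_le hq (norm_nonneg b) (norm_nonneg a) hb ha).trans
      (by gcongr; exact abs_norm_sub_norm_le a b)
  calc ‖powNL q a - powNL q b‖ = ‖‖a‖ ^ q • (a - b) + (‖a‖ ^ q - ‖b‖ ^ q) • b‖ := by
        congr 1; simp only [powNL]; module
    _ ≤ ‖a‖ ^ q * ‖a - b‖ + |‖a‖ ^ q - ‖b‖ ^ q| * ‖b‖ := by
        refine (norm_add_le _ _).trans_eq ?_
        rw [norm_smul, norm_smul, Real.norm_of_nonneg (by positivity), Real.norm_eq_abs]
    _ ≤ M ^ q * ‖a - b‖ + q * M ^ (q - 1) * ‖a - b‖ * M := by gcongr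
    _ = (q + 1) * M ^ q * ‖a - b‖ := by
        rw [← sub_add_cancel q 1, Real.rpow_add_one' hM (by linarith), add_sub_cancel_right]; ring

theorem lipschitzOnWith_powNL (hq : 1 ≤ q) (hM : 0 ≤ M) :
    LipschitzOnWith ((q + 1) * M ^ q).toNNReal (powNL q) (Metric.closedBall (0 : F) M) :=
  LipschitzOnWith.of_dist_le_mul fun a ha b hb => by
    rw [Real.coe_toNNReal _ (by positivity), dist_eq_norm, dist_eq_norm]
    exact norm_powNL_sub_le hq (mem_closedBall_zero_iff.1 ha) (mem_closedBall_zero_iff.1 hb)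

end Normed

variable [InnerProductSpace ℝ F] {q M : ℝ}

theorem two_mul_norm_le_norm_add_add_norm_sub (b w : F) : 2 * ‖b‖ ≤ ‖b + w‖ + ‖b - w‖ := by
  have := norm_add_le (b + w) (b - w)
  rwa [add_add_sub_cancel, ← two_smul ℝ b, norm_smul, Real.norm_two] at this

theorem norm_mul_second_diff_norm_le (b w : F) :
    ‖b‖ * (‖b + w‖ + ‖b - w‖ - 2 * ‖b‖) ≤ ‖w‖ ^ 2 := by
  have := parallelogram_law_with_norm ℝ b w
  nlinarith [sq_nonneg (‖b + w‖ - ‖b - w‖), two_mul_norm_le_norm_add_add_norm_sub b w]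

theorem norm_mul_second_diff_rpow_norm_le (hq : 1 ≤ q) {b w : F} (hb : ‖b‖ ≤ M)
    (hadd : ‖b + w‖ ≤ M) (hsub : ‖b - w‖ ≤ M) :
    ‖b‖ * |‖b + w‖ ^ q + ‖b - w‖ ^ q - 2 * ‖b‖ ^ q| ≤
      q * (2 * q + 3) * M ^ (q - 1) * ‖w‖ ^ 2 := by
  have hM : 0 ≤ M := (norm_nonneg b).trans hb
  have tangent {x : ℝ} (hx : 0 ≤ x) (hxM : x ≤ M) (hxb : |x - ‖b‖| ≤ ‖w‖) :
      ‖b‖ * (x ^ q - ‖b‖ ^ q - q * ‖b‖ ^ (q - 1) * (x - ‖b‖)) ≤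
        q * (q + 1) * M ^ (q - 1) * ‖w‖ ^ 2 := by
    refine (mul_rpow_sub_tangent_le hq (norm_nonneg b) hx hb hxM).trans ?_
    rw [← sq_abs (x - ‖b‖)]
    gcongr
  have tangent_add := tangent (norm_nonneg (b + w)) hadd (by
    simpa only [add_sub_cancel_left] using abs_norm_sub_norm_le (b + w) b)
  have tangent_sub := tangent (norm_nonneg (b - w)) hsub (by
    simpa only [sub_sub_cancel_left, norm_neg] using abs_norm_sub_norm_le (b - w) b)
  have linear : q * ‖b‖ ^ (q - 1) * (‖b‖ * (‖b + w‖ + ‖b - w‖ - 2 * ‖b‖)) ≤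
      q * M ^ (q - 1) * ‖w‖ ^ 2 := by
    have hpow := Real.rpow_le_rpow (norm_nonneg b) hb (sub_nonneg.2 hq)
    calc _ ≤ q * ‖b‖ ^ (q - 1) * ‖w‖ ^ 2 := by gcongr; exact norm_mul_second_diff_norm_le b w
      _ ≤ _ := by gcongr
  have nonneg : 0 ≤ ‖b + w‖ ^ q + ‖b - w‖ ^ q - 2 * ‖b‖ ^ q := by
    have h := mul_nonneg (by positivity : 0 ≤ q * ‖b‖ ^ (q - 1))
      (sub_nonneg.2 (two_mul_norm_le_norm_add_add_norm_sub b w))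
    linarith [rpow_sub_rpow_le hq (norm_nonneg (b + w)) (norm_nonneg b),
      rpow_sub_rpow_le hq (norm_nonneg (b - w)) (norm_nonneg b)]
  rw [abs_of_nonneg nonneg]
  linarith

theorem norm_powNL_symm_second_diff_le (hq : 1 ≤ q) {b w : F} (hb : ‖b‖ ≤ M)
    (hadd : ‖b + w‖ ≤ M) (hsub : ‖b - w‖ ≤ M) :
    ‖powNL q (b + w) - (2 : ℝ) • powNL q b + powNL q (b - w)‖ ≤
      q * (2 * q + 5) * M ^ (q - 1) * ‖w‖ ^ 2 := by
  have hM : 0 ≤ M := (norm_nonneg b).trans hb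
  have first_diff : |‖b + w‖ ^ q - ‖b - w‖ ^ q| ≤ q * M ^ (q - 1) * (2 * ‖w‖) := by
    refine (abs_rpow_sub_rpow_le hq (norm_nonneg _) (norm_nonneg _) hsub hadd).trans ?_
    gcongr
    calc |‖b + w‖ - ‖b - w‖| ≤ ‖b + w - (b - w)‖ := abs_norm_sub_norm_le _ _
      _ = 2 * ‖w‖ := by rw [add_sub_sub_cancel, ← two_smul ℝ w, norm_smul, Real.norm_two]
  calc _ = ‖(‖b + w‖ ^ q + ‖b - w‖ ^ q - 2 * ‖b‖ ^ q) • b +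
          (‖b + w‖ ^ q - ‖b - w‖ ^ q) • w‖ := by
        congr 1; simp only [powNL]; module
    _ ≤ ‖b‖ * |‖b + w‖ ^ q + ‖b - w‖ ^ q - 2 * ‖b‖ ^ q| +
          |‖b + w‖ ^ q - ‖b - w‖ ^ q| * ‖w‖ := by
        refine (norm_add_le _ _).trans_eq ?_
        rw [norm_smul, norm_smul, Real.norm_eq_abs, Real.norm_eq_abs, mul_comm ‖b‖]
    _ ≤ q * (2 * q + 3) * M ^ (q - 1) * ‖w‖ ^ 2 + q * M ^ (q - 1) * (2 * ‖w‖) * ‖w‖ := by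
        refine add_le_add (norm_mul_second_diff_rpow_norm_le hq hb hadd hsub) ?_
        gcongr
    _ = q * (2 * q + 5) * M ^ (q - 1) * ‖w‖ ^ 2 := by ring

theorem norm_powNL_second_diff_le (hq : 1 ≤ q) {a b c : F} (ha : ‖a‖ ≤ M) (hb : ‖b‖ ≤ M)
    (hc : ‖c‖ ≤ M) :
    ‖powNL q a - (2 : ℝ) • powNL q b + powNL q c‖ ≤
      (q + 1) * (3 * M) ^ q * ‖a - (2 : ℝ) • b + c‖ +
        q * (2 * q + 5) * (3 * M) ^ (q - 1) * ‖a - b‖ ^ 2 := by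
  -- Replacing `c` by the reflection of `a` in `b` reduces to a symmetric second difference.
  obtain ⟨w, rfl⟩ : ∃ w, b + w = a := ⟨a - b, add_sub_cancel b a⟩
  have hM : M ≤ 3 * M := by linarith [(norm_nonneg b).trans hb]
  have hsub : ‖b - w‖ ≤ 3 * M := by
    calc ‖b - w‖ = ‖b + b - (b + w)‖ := by congr 1; abel
      _ ≤ ‖b‖ + ‖b‖ + ‖b + w‖ := (norm_sub_le _ _).trans (by gcongr; exact norm_add_le _ _)
      _ ≤ 3 * M := by linarith
  calc _ = ‖(powNL q c - powNL q (b - w)) +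
          (powNL q (b + w) - (2 : ℝ) • powNL q b + powNL q (b - w))‖ := by congr 1; abel
    _ ≤ (q + 1) * (3 * M) ^ q * ‖c - (b - w)‖ +
          q * (2 * q + 5) * (3 * M) ^ (q - 1) * ‖w‖ ^ 2 :=
        (norm_add_le _ _).trans (add_le_add (norm_powNL_sub_le hq (hc.trans hM) hsub)
          (norm_powNL_symm_second_diff_le hq (hb.trans hM) (ha.trans hM) hsub))
    _ = _ := by
        rw [show c - (b - w) = b + w - (2 : ℝ) • b + c by module, add_sub_cancel_left]

end PowerNonlinearity

section Multiplier

/-- Bounded continuous symbols of Fourier multipliers on `L²(ℝᵈ)`. -/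
abbrev Symbol (d : ℕ) : Type := EuclideanSpace ℝ (Fin d) →ᵇ ℂ

variable {d : ℕ}

theorem fourier_ext {f g : L2Space d} (h : (𝓕 f : L2Space d) =ᵐ[volume] (𝓕 g : L2Space d)) :
    f = g :=
  (Lp.fourierTransformₗᵢ (EuclideanSpace ℝ (Fin d)) ℂ).injective (Lp.ext h)

theorem Symbol.memLp_top (b : Symbol d) : MemLp b ∞ :=
  memLp_top_of_bound b.continuous.aestronglyMeasurable ‖b‖
    (Eventually.of_forall b.norm_coe_le_norm)

/-- The Fourier multiplier `𝓕⁻¹ b 𝓕` on `L²` with symbol `b`. -/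
def multiplierCLM (b : Symbol d) : L2Space d →L[ℂ] L2Space d :=
  let F := Lp.fourierTransformₗᵢ (EuclideanSpace ℝ (Fin d)) ℂ
  (F.symm : L2Space d →L[ℂ] L2Space d) ∘L
    (ContinuousLinearMap.mul ℂ ℂ).holderL volume ∞ 2 2 b.memLp_top.toLp ∘L
    (F : L2Space d →L[ℂ] L2Space d)

theorem fourier_multiplierCLM (b : Symbol d) (f : L2Space d) :
    (𝓕 (multiplierCLM b f) : L2Space d) =ᵐ[volume] fun ξ => b ξ * (𝓕 f : L2Space d) ξ := by
  have h : (𝓕 (multiplierCLM b f) : L2Space d) =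
      (ContinuousLinearMap.mul ℂ ℂ).holder 2 b.memLp_top.toLp (𝓕 f : L2Space d) :=
    FourierTransform.fourier_fourierInv_eq _
  rw [h]
  filter_upwards [(ContinuousLinearMap.mul ℂ ℂ).coeFn_holder (r := 2) b.memLp_top.toLp
    (𝓕 f : L2Space d), b.memLp_top.coeFn_toLp] with ξ h₁ h₂
  rw [h₁, h₂, ContinuousLinearMap.mul_apply']

theorem multiplierCLM_eq {b : Symbol d} {f g : L2Space d}
    (h : (𝓕 g : L2Space d) =ᵐ[volume] fun ξ => b ξ * (𝓕 f : L2Space d) ξ) :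
    multiplierCLM b f = g :=
  fourier_ext ((fourier_multiplierCLM b f).trans h.symm)

/-- The functional calculus `b ↦ 𝓕⁻¹ b 𝓕` of Fourier multipliers, as an algebra homomorphism. -/
def multiplier : Symbol d →ₐ[ℂ] (L2Space d →L[ℂ] L2Space d) :=
  AlgHom.ofLinearMap
    { toFun := multiplierCLM
      map_add' := fun a b => ContinuousLinearMap.ext fun f => multiplierCLM_eq <| by
        rw [add_apply, FourierTransform.fourier_add]
        filter_upwards [fourier_multiplierCLM a f, fourier_multiplierCLM b f,
          Lp.coeFn_add (𝓕 (multiplierCLM a f) : L2Space d) (𝓕 (multiplierCLM b f))] with ξ ha hb h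
        rw [h, Pi.add_apply, ha, hb, BoundedContinuousFunction.add_apply, add_mul]
      map_smul' := fun c b => ContinuousLinearMap.ext fun f => multiplierCLM_eq <| by
        rw [smul_apply, RingHom.id_apply, FourierTransform.fourier_smul]
        filter_upwards [fourier_multiplierCLM b f,
          Lp.coeFn_smul c (𝓕 (multiplierCLM b f) : L2Space d)] with ξ hb h
        rw [h, Pi.smul_apply, hb, BoundedContinuousFunction.smul_apply, smul_mul_assoc] }
    (ContinuousLinearMap.ext fun f => multiplierCLM_eq <| by simp)
    (fun a b => ContinuousLinearMap.ext fun f => multiplierCLM_eq <| by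
      filter_upwards [fourier_multiplierCLM a (multiplierCLM b f), fourier_multiplierCLM b f]
        with ξ ha hb
      exact ha.trans (by rw [hb, BoundedContinuousFunction.mul_apply, mul_assoc]))

theorem fourier_multiplier (b : Symbol d) (f : L2Space d) :
    (𝓕 (multiplier b f) : L2Space d) =ᵐ[volume] fun ξ => b ξ * (𝓕 f : L2Space d) ξ :=
  fourier_multiplierCLM b f

theorem multiplier_mul_apply (a b : Symbol d) (f : L2Space d) :
    multiplier (a * b) f = multiplier a (multiplier b f) := by
  rw [map_mul, mul_apply_eq_comp]

theorem multiplier_comm (a b : Symbol d) (f : L2Space d) :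
    multiplier a (multiplier b f) = multiplier b (multiplier a f) := by
  rw [← multiplier_mul_apply, mul_comm, multiplier_mul_apply]

theorem norm_multiplier_le_norm_multiplier {b c : Symbol d} (h : ∀ ξ, ‖b ξ‖ ≤ ‖c ξ‖)
    (f : L2Space d) : ‖multiplier b f‖ ≤ ‖multiplier c f‖ := by
  rw [← Lp.norm_fourier_eq (multiplier b f), ← Lp.norm_fourier_eq (multiplier c f)]
  refine Lp.norm_le_norm_of_ae_le ?_
  filter_upwards [fourier_multiplier b f, fourier_multiplier c f] with ξ hb hc
  rw [hb, hc, norm_mul, norm_mul]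
  gcongr
  exact h ξ

theorem norm_sq_eq_integral (f : L2Space d) : ‖f‖ ^ 2 = ∫ x, ‖f x‖ ^ 2 := by
  rw [← inner_self_eq_norm_sq (𝕜 := ℂ) f, L2.inner_def, ← integral_re (L2.integrable_inner f f)]
  simp only [inner_self_eq_norm_sq]

theorem norm_multiplier_sq (b : Symbol d) (f : L2Space d) :
    ‖multiplier b f‖ ^ 2 = ∫ ξ, ‖b ξ * (𝓕 f : L2Space d) ξ‖ ^ 2 := by
  rw [← Lp.norm_fourier_eq, norm_sq_eq_integral]
  exact integral_congr_ae ((fourier_multiplier b f).fun_comp (‖·‖ ^ 2))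

theorem tendsto_multiplier {ι : Type*} {l : Filter ι} [l.IsCountablyGenerated]
    {b : ι → Symbol d} {c : Symbol d} {C : ℝ} (hbd : ∀ᶠ i in l, ∀ ξ, ‖b i ξ‖ ≤ C)
    (hlim : ∀ ξ, Tendsto (b · ξ) l (𝓝 (c ξ))) (f : L2Space d) :
    Tendsto (fun i => multiplier (b i) f) l (𝓝 (multiplier c f)) := by
  rw [tendsto_iff_norm_sub_tendsto_zero]
  suffices h : Tendsto (fun i => ‖multiplier (b i - c) f‖ ^ 2) l (𝓝 0) by
    simpa [map_sub] using h.sqrt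
  simp only [norm_multiplier_sq]
  have hint : Integrable fun ξ => ((C + ‖c‖) * ‖(𝓕 f : L2Space d) ξ‖) ^ 2 := by
    simp only [mul_pow]
    exact ((memLp_two_iff_integrable_sq_norm (Lp.aestronglyMeasurable _)).1
      (Lp.memLp (𝓕 f : L2Space d))).const_mul _
  suffices h : Tendsto (fun i => ∫ ξ, ‖(b i - c) ξ * (𝓕 f : L2Space d) ξ‖ ^ 2) l
      (𝓝 (∫ _ : EuclideanSpace ℝ (Fin d), (0 : ℝ))) by simpa using h
  refine tendsto_integral_filter_of_dominated_convergence _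
    (Eventually.of_forall fun i => ((b i - c).continuous.aestronglyMeasurable.mul
      (Lp.aestronglyMeasurable _)).norm.pow 2) ?_ hint ?_
  · filter_upwards [hbd] with i hi
    refine Eventually.of_forall fun ξ => ?_
    rw [norm_pow, norm_norm, norm_mul]
    gcongr
    exact (norm_sub_le _ _).trans (add_le_add (hi ξ) (c.norm_coe_le_norm ξ))
  · refine Eventually.of_forall fun ξ => ?_
    simpa using (((hlim ξ).sub_const (c ξ)).mul_const ((𝓕 f : L2Space d) ξ)).norm.pow 2

end Multiplier

section Bessel

variable {d : ℕ}

theorem norm_bessel (f : H2Space d) : ‖bessel f‖ = ‖f‖ := rfl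

theorem toDistr_bessel (f : H2Space d) :
    toDistr (bessel f) =
      TemperedDistribution.besselPotential (EuclideanSpace ℝ (Fin d)) ℂ 2 (toDistr (toL2 f)) :=
  toDistr_besselFun f

theorem fourierMultiplierCLM_toDistr {b : Symbol d}
    (hb : (b : EuclideanSpace ℝ (Fin d) → ℂ).HasTemperateGrowth) (f : L2Space d) :
    TemperedDistribution.fourierMultiplierCLM ℂ b (toDistr f) = toDistr (multiplier b f) := by
  have hF : b.memLp_top.toLp • 𝓕 f = (𝓕 (multiplier b f) : L2Space d) := by
    apply Lp.ext
    filter_upwards [Lp.coeFn_lpSMul (r := 2) b.memLp_top.toLp (𝓕 f : L2Space d),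
      b.memLp_top.coeFn_toLp, fourier_multiplier b f] with ξ h₁ h₂ h₃
    rw [h₁, Pi.smul_apply', h₂, h₃, smul_eq_mul]
  calc TemperedDistribution.fourierMultiplierCLM ℂ b (toDistr f)
      = 𝓕⁻ (TemperedDistribution.smulLeftCLM ℂ b (toDistr (𝓕 f))) :=
        congrArg (fun T => 𝓕⁻ (TemperedDistribution.smulLeftCLM ℂ b T))
          (Lp.fourier_toTemperedDistribution_eq f)
    _ = 𝓕⁻ (toDistr (𝓕 (multiplier b f))) := by
        rw [← hF]
        exact congrArg _ (Lp.toTemperedDistribution_smul_eq hb b.memLp_top _).symm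
    _ = toDistr (multiplier b f) := by
        rw [toDistr, Lp.toTemperedDistributionCLM_apply, Lp.fourierInv_toTemperedDistribution_eq,
          FourierTransform.fourierInv_fourier_eq]
        rfl

/-- The symbol `(1 + |ξ|²)⁻¹` of the inverse of the Bessel potential. -/
def besselSymbol (d : ℕ) : Symbol d :=
  BoundedContinuousFunction.ofNormedAddCommGroup
    (fun ξ => (((1 + ‖ξ‖ ^ 2)⁻¹ : ℝ) : ℂ))
    (Complex.continuous_ofReal.comp <| (by fun_prop : Continuous fun ξ : EuclideanSpace ℝ (Fin d) =>
      1 + ‖ξ‖ ^ 2).inv₀ fun ξ => by positivity) 1 fun ξ => by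
      rw [Complex.norm_real, Real.norm_of_nonneg (by positivity)]
      exact inv_le_one_of_one_le₀ (by simp)

theorem norm_besselSymbol_le (ξ : EuclideanSpace ℝ (Fin d)) : ‖besselSymbol d ξ‖ ≤ 1 :=
  ((besselSymbol d).norm_coe_le_norm ξ).trans
    (BoundedContinuousFunction.norm_ofNormedAddCommGroup_le _ zero_le_one _)

theorem besselSymbol_apply (ξ : EuclideanSpace ℝ (Fin d)) :
    besselSymbol d ξ = (1 + (‖ξ‖ : ℂ) ^ 2)⁻¹ := by
  simp [besselSymbol]

theorem one_add_normSq_ne_zero (ξ : EuclideanSpace ℝ (Fin d)) : 1 + (‖ξ‖ : ℂ) ^ 2 ≠ 0 := by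
  exact_mod_cast (by positivity : (1 + ‖ξ‖ ^ 2 : ℝ) ≠ 0)

theorem besselSymbol_eq_rpow : (besselSymbol d : EuclideanSpace ℝ (Fin d) → ℂ) =
    fun ξ => (((1 + ‖ξ‖ ^ 2) ^ (-2 / 2 : ℝ) : ℝ) : ℂ) := by
  ext ξ
  rw [neg_div_self two_ne_zero, Real.rpow_neg_one]
  rfl

theorem besselPotential_neg_two_toDistr (g : L2Space d) :
    TemperedDistribution.besselPotential (EuclideanSpace ℝ (Fin d)) ℂ (-2) (toDistr g) =
      toDistr (multiplier (besselSymbol d) g) := by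
  rw [← fourierMultiplierCLM_toDistr (by rw [besselSymbol_eq_rpow]; fun_prop),
    besselSymbol_eq_rpow]
  rfl

theorem multiplier_besselSymbol_bessel (f : H2Space d) :
    multiplier (besselSymbol d) (bessel f) = toL2 f := by
  apply toDistr_injective
  rw [← besselPotential_neg_two_toDistr, TemperedDistribution.besselPotential_neg_apply_eq_iff,
    toDistr_bessel]

theorem bessel_surjective : Function.Surjective (bessel (d := d)) := by
  intro g
  have h : TemperedDistribution.besselPotential (EuclideanSpace ℝ (Fin d)) ℂ 2
      (toDistr (multiplier (besselSymbol d) g)) = toDistr g := by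
    rw [← TemperedDistribution.besselPotential_neg_apply_eq_iff, besselPotential_neg_two_toDistr]
  have hmem : TemperedDistribution.MemSobolev 2 2 (toDistr (multiplier (besselSymbol d) g)) :=
    ⟨g, h⟩
  refine ⟨H2Space.mk _ hmem, toDistr_injective ?_⟩
  rw [toDistr_bessel, toL2_mk, h]

/-- The Bessel potential as an isometric isomorphism of `H²` onto `L²`. -/
def besselEquiv (d : ℕ) : H2Space d ≃ₗᵢ[ℂ] L2Space d :=
  LinearIsometryEquiv.ofSurjective ⟨bessel, norm_bessel⟩ bessel_surjective

theorem bessel_besselEquiv_symm (g : L2Space d) : bessel ((besselEquiv d).symm g) = g :=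
  (besselEquiv d).apply_symm_apply g

theorem toL2_besselEquiv_symm (g : L2Space d) :
    toL2 ((besselEquiv d).symm g) = multiplier (besselSymbol d) g := by
  rw [← multiplier_besselSymbol_bessel, bessel_besselEquiv_symm]

theorem besselPotential_two_eq (T : 𝓢'(EuclideanSpace ℝ (Fin d), ℂ)) :
    TemperedDistribution.besselPotential (EuclideanSpace ℝ (Fin d)) ℂ 2 T =
      T + TemperedDistribution.fourierMultiplierCLM ℂ
        (fun ξ : EuclideanSpace ℝ (Fin d) => Complex.ofReal (‖ξ‖ ^ 2)) T := by
  have hsymbol : (fun ξ : EuclideanSpace ℝ (Fin d) =>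
      Complex.ofReal ((1 + ‖ξ‖ ^ 2) ^ (2 / 2 : ℝ))) =
        (fun _ => 1) + fun ξ => Complex.ofReal (‖ξ‖ ^ 2) := by
    ext ξ
    simp
  rw [TemperedDistribution.besselPotential, TemperedDistribution.fourierMultiplierCLM_apply,
    TemperedDistribution.fourierMultiplierCLM_apply, hsymbol,
    TemperedDistribution.smulLeftCLM_add (by fun_prop) (by fun_prop), add_apply,
    TemperedDistribution.smulLeftCLM_const, one_smul, FourierTransform.fourierInv_add,
    FourierTransform.fourierInv_fourier_eq]

theorem laplace_eq (f : H2Space d) :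
    laplace f = (((2 * Real.pi) ^ 2 : ℝ) : ℂ) • (toL2 f - bessel f) := by
  apply toDistr_injective
  rw [toDistr_laplace, TemperedDistribution.laplacian_eq_fourierMultiplierCLM, map_smul, map_sub,
    toDistr_bessel, besselPotential_two_eq, sub_add_cancel_left, smul_neg, neg_smul]
  rfl

theorem norm_toL2_le (f : H2Space d) : ‖toL2 f‖ ≤ ‖f‖ := by
  have h := norm_multiplier_le_norm_multiplier (b := besselSymbol d) (c := 1)
    (fun ξ => (norm_besselSymbol_le ξ).trans_eq norm_one.symm) (bessel f)
  rwa [map_one, one_apply_eq_self, multiplier_besselSymbol_bessel, norm_bessel] at h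

end Bessel

section H2Ball

variable {d : ℕ}

/-- The closed ball of radius `R` of `H²`, as a set of `L²` functions: the a priori bounds are in
`H²` while the convergence of the iteration is only in `L²`. -/
def H2Ball (d : ℕ) (R : ℝ) : Set (L2Space d) := toL2 '' Metric.closedBall (0 : H2Space d) R

theorem toL2_mem_H2Ball_iff {f : H2Space d} {R : ℝ} : toL2 f ∈ H2Ball d R ↔ ‖f‖ ≤ R := by
  rw [H2Ball, toL2_injective.mem_set_image, mem_closedBall_zero_iff]

theorem mem_H2Ball_of_eLpNorm_le {R : ℝ} (hR : 0 ≤ R) {f : L2Space d}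
    (h : eLpNorm (fun ξ => (1 + (‖ξ‖ : ℂ) ^ 2) * (𝓕 f : L2Space d) ξ) 2 volume ≤
      ENNReal.ofReal R) : f ∈ H2Ball d R := by
  have hmem : MemLp (fun ξ => (1 + (‖ξ‖ : ℂ) ^ 2) * (𝓕 f : L2Space d) ξ) 2 :=
    ⟨(by fun_prop : Continuous fun ξ : EuclideanSpace ℝ (Fin d) =>
      1 + (‖ξ‖ : ℂ) ^ 2).aestronglyMeasurable.mul (Lp.aestronglyMeasurable _),
      h.trans_lt ENNReal.ofReal_lt_top⟩
  have hf : toL2 ((besselEquiv d).symm (𝓕⁻ (hmem.toLp _))) = f := by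
    rw [toL2_besselEquiv_symm]
    refine multiplierCLM_eq ?_
    rw [FourierTransform.fourier_fourierInv_eq]
    filter_upwards [hmem.coeFn_toLp] with ξ hξ
    rw [hξ, besselSymbol_apply, inv_mul_cancel_left₀ (one_add_normSq_ne_zero ξ)]
  refine ⟨_, mem_closedBall_zero_iff.2 ?_, hf⟩
  rw [LinearIsometryEquiv.norm_map]
  refine ((Lp.fourierTransformₗᵢ _ ℂ).symm.norm_map _).trans_le ?_
  rw [Lp.norm_toLp]
  exact ENNReal.toReal_le_of_le_ofReal hR h

theorem mem_H2Ball_of_tendsto_symbol {R : ℝ} {b : ℕ → Symbol d}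
    (hb : ∀ ξ, Tendsto (b · ξ) atTop (𝓝 (1 + (‖ξ‖ : ℂ) ^ 2))) {f : L2Space d}
    (hf : ∀ n, ‖multiplier (b n) f‖ ≤ R) : f ∈ H2Ball d R := by
  have hlim : ∀ᵐ ξ, Tendsto (fun n => (𝓕 (multiplier (b n) f) : L2Space d) ξ) atTop
      (𝓝 ((1 + (‖ξ‖ : ℂ) ^ 2) * (𝓕 f : L2Space d) ξ)) := by
    filter_upwards [ae_all_iff.2 fun n => fourier_multiplier (b n) f] with ξ hξ
    simpa only [hξ] using (hb ξ).mul_const _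
  refine mem_H2Ball_of_eLpNorm_le ((norm_nonneg _).trans (hf 0)) <|
    (Lp.eLpNorm_lim_le_liminf_eLpNorm (fun n => Lp.aestronglyMeasurable _) _ hlim).trans <|
      liminf_le_of_frequently_le' (Frequently.of_forall fun n => ?_)
  rw [← ENNReal.ofReal_toReal (Lp.eLpNorm_ne_top _), ← Lp.norm_def, Lp.norm_fourier_eq]
  exact ENNReal.ofReal_le_ofReal (hf n)

/-- The symbol `min (1 + |ξ|²) n`, a bounded truncation of the symbol of the Bessel potential. -/
def truncatedSymbol (d n : ℕ) : Symbol d :=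
  BoundedContinuousFunction.ofNormedAddCommGroup
    (fun ξ => ((min (1 + ‖ξ‖ ^ 2) n : ℝ) : ℂ)) (by fun_prop) n fun ξ => by
      rw [Complex.norm_real, Real.norm_of_nonneg (by positivity)]
      exact min_le_right _ _

theorem truncatedSymbol_apply (n : ℕ) (ξ : EuclideanSpace ℝ (Fin d)) :
    truncatedSymbol d n ξ = ((min (1 + ‖ξ‖ ^ 2) n : ℝ) : ℂ) := rfl

theorem tendsto_truncatedSymbol (ξ : EuclideanSpace ℝ (Fin d)) :
    Tendsto (truncatedSymbol d · ξ) atTop (𝓝 (1 + (‖ξ‖ : ℂ) ^ 2)) := by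
  refine tendsto_const_nhds.congr' ?_
  filter_upwards [eventually_ge_atTop ⌈1 + ‖ξ‖ ^ 2⌉₊] with n hn
  rw [truncatedSymbol_apply, min_eq_left (Nat.ceil_le.1 hn)]
  push_cast
  rfl

theorem norm_multiplier_truncatedSymbol_le (n : ℕ) (f : H2Space d) :
    ‖multiplier (truncatedSymbol d n) (toL2 f)‖ ≤ ‖f‖ := by
  have h := norm_multiplier_le_norm_multiplier (b := truncatedSymbol d n * besselSymbol d)
    (c := 1) (fun ξ => ?_) (bessel f)
  · rwa [multiplier_mul_apply, multiplier_besselSymbol_bessel, map_one, one_apply_eq_self,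
      norm_bessel] at h
  · refine LE.le.trans_eq ?_ norm_one.symm
    change ‖((min (1 + ‖ξ‖ ^ 2) n : ℝ) : ℂ) * (((1 + ‖ξ‖ ^ 2)⁻¹ : ℝ) : ℂ)‖ ≤ 1
    rw [← Complex.ofReal_mul, Complex.norm_real, Real.norm_of_nonneg (by positivity),
      mul_inv_le_iff₀ (by positivity), one_mul]
    exact min_le_left _ _

theorem mem_H2Ball_iff {R : ℝ} {f : L2Space d} :
    f ∈ H2Ball d R ↔ ∀ n : ℕ, ‖multiplier (truncatedSymbol d n) f‖ ≤ R := by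
  refine ⟨?_, mem_H2Ball_of_tendsto_symbol tendsto_truncatedSymbol⟩
  rintro ⟨g, hg, rfl⟩ n
  exact (norm_multiplier_truncatedSymbol_le n g).trans (mem_closedBall_zero_iff.1 hg)

theorem isClosed_H2Ball (d : ℕ) (R : ℝ) : IsClosed (H2Ball d R) := by
  have h : H2Ball d R = ⋂ n : ℕ, {f | ‖multiplier (truncatedSymbol d n) f‖ ≤ R} := by
    ext f
    simp only [mem_H2Ball_iff, mem_iInter, mem_ofPred_eq]
  rw [h]
  exact isClosed_iInter fun n => isClosed_le (map_continuous _).norm continuous_const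

theorem H2Ball_mono {R R' : ℝ} (h : R ≤ R') : H2Ball d R ⊆ H2Ball d R' :=
  image_mono (Metric.closedBall_subset_closedBall h)

theorem add_mem_H2Ball {R R' : ℝ} {f f' : L2Space d} (hf : f ∈ H2Ball d R)
    (hf' : f' ∈ H2Ball d R') : f + f' ∈ H2Ball d (R + R') := by
  obtain ⟨g, hg, rfl⟩ := hf
  obtain ⟨g', hg', rfl⟩ := hf'
  rw [← map_add, toL2_mem_H2Ball_iff]
  rw [mem_closedBall_zero_iff] at hg hg'
  exact (norm_add_le _ _).trans (add_le_add hg hg')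

theorem smul_mem_H2Ball {R : ℝ} {c : ℂ} {f : L2Space d} (hc : ‖c‖ ≤ 1) (hf : f ∈ H2Ball d R) :
    c • f ∈ H2Ball d R := by
  obtain ⟨g, hg, rfl⟩ := hf
  rw [← map_smul, toL2_mem_H2Ball_iff, norm_smul]
  exact (mul_le_of_le_one_left (norm_nonneg g) hc).trans (mem_closedBall_zero_iff.1 hg)

theorem integral_mem_H2Ball {C s t : ℝ} {F : ℝ → L2Space d} (hst : s ≤ t)
    (hF : IntervalIntegrable F volume s t) (h : ∀ r ∈ Icc s t, F r ∈ H2Ball d C) :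
    ∫ r in s..t, F r ∈ H2Ball d (C * (t - s)) := by
  rw [mem_H2Ball_iff]
  intro n
  rw [← ContinuousLinearMap.intervalIntegral_comp_comm _ hF, ← abs_of_nonneg (sub_nonneg.2 hst)]
  refine intervalIntegral.norm_integral_le_of_norm_le_const fun r hr => ?_
  rw [uIoc_of_le hst] at hr
  exact mem_H2Ball_iff.1 (h r (Ioc_subset_Icc_self hr)) n

end H2Ball

section SobolevEmbedding

variable {d : ℕ}

theorem integral_smul_fourierInv_eq {f : L2Space d} (hf : Integrable f)
    (G : 𝓢(EuclideanSpace ℝ (Fin d), ℂ)) :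
    ∫ x, G x • (𝓕⁻ f : L2Space d) x =
      ∫ x, G x • 𝓕⁻ (f : EuclideanSpace ℝ (Fin d) → ℂ) x := by
  have hflip : (-innerₗ (EuclideanSpace ℝ (Fin d))).flip = -innerₗ (EuclideanSpace ℝ (Fin d)) := by
    ext
    simp [real_inner_comm]
  calc ∫ x, G x • (𝓕⁻ f : L2Space d) x
      = toDistr (𝓕⁻ f) G := (Lp.toTemperedDistribution_apply _ _).symm
    _ = toDistr f (𝓕⁻ G) := by
        rw [toDistr, Lp.toTemperedDistributionCLM_apply,
          ← Lp.fourierInv_toTemperedDistribution_eq]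
        rfl
    _ = ∫ x, (𝓕⁻ G) x • f x := Lp.toTemperedDistribution_apply _ _
    _ = ∫ x, G x • 𝓕⁻ (f : EuclideanSpace ℝ (Fin d) → ℂ) x := by
        have h := VectorFourier.integral_fourierIntegral_smul_eq_flip (e := Real.fourierChar)
          (μ := volume) (ν := volume) (L := -innerₗ (EuclideanSpace ℝ (Fin d)))
          Real.continuous_fourierChar continuous_inner.neg G.integrable hf
        rw [hflip] at h
        rwa [SchwartzMap.fourierInv_coe]

theorem fourierInv_ae_eq_of_integrable {f : L2Space d} (hf : Integrable f) :
    (𝓕⁻ f : L2Space d) =ᵐ[volume] 𝓕⁻ (f : EuclideanSpace ℝ (Fin d) → ℂ) := by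
  have hcont : Continuous (𝓕⁻ (f : EuclideanSpace ℝ (Fin d) → ℂ)) :=
    VectorFourier.fourierIntegral_continuous Real.continuous_fourierChar
      (L := -innerₗ (EuclideanSpace ℝ (Fin d))) continuous_inner.neg hf
  have hloc : LocallyIntegrable (𝓕⁻ f : L2Space d) volume :=
    (Lp.memLp _).locallyIntegrable one_le_two
  refine ae_eq_of_integral_contDiff_smul_eq hloc hcont.locallyIntegrable
    fun g g_smooth g_supp => ?_
  have hG_supp : HasCompactSupport (Complex.ofRealCLM ∘ g) := g_supp.comp_left rfl
  have hG_smooth : ContDiff ℝ (⊤ : ℕ∞) (Complex.ofRealCLM ∘ g) := by fun_prop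
  simpa using integral_smul_fourierInv_eq hf (hG_supp.toSchwartzMap hG_smooth)

theorem ae_norm_le_integral_norm_fourier {f : L2Space d}
    (hf : Integrable (𝓕 f : L2Space d)) :
    ∀ᵐ x, ‖f x‖ ≤ ∫ ξ, ‖(𝓕 f : L2Space d) ξ‖ := by
  have h := fourierInv_ae_eq_of_integrable hf
  rw [FourierTransform.fourierInv_fourier_eq] at h
  filter_upwards [h] with x hx
  rw [hx]
  exact VectorFourier.norm_fourierIntegral_le_integral_norm _ _ _ _ _

theorem memLp_two_besselSymbol (hd : d ≤ 3) : MemLp (besselSymbol d) 2 := by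
  rw [memLp_two_iff_integrable_sq_norm (besselSymbol d).continuous.aestronglyMeasurable]
  have hdim : (Module.finrank ℝ (EuclideanSpace ℝ (Fin d)) : ℝ) < 4 := by
    rw [finrank_euclideanSpace_fin]
    exact_mod_cast Nat.lt_succ_of_le hd
  refine (integrable_rpow_neg_one_add_norm_sq hdim).congr (Eventually.of_forall fun ξ => ?_)
  simp only [besselSymbol_eq_rpow]
  rw [Complex.norm_real, Real.norm_of_nonneg (by positivity),
    ← Real.rpow_mul_natCast (by positivity)]
  norm_num

theorem exists_ae_norm_toL2_le (hd : d ≤ 3) :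
    ∃ C, 0 ≤ C ∧ ∀ f : H2Space d, ∀ᵐ x, ‖toL2 f x‖ ≤ C * ‖f‖ := by
  let m := (memLp_two_besselSymbol hd).toLp
  refine ⟨‖m‖, norm_nonneg m, fun f => ?_⟩
  let v : Lp ℂ 1 (volume : Measure (EuclideanSpace ℝ (Fin d))) := m • (𝓕 (bessel f) : L2Space d)
  have hv : (𝓕 (toL2 f) : L2Space d) =ᵐ[volume] v := by
    rw [← multiplier_besselSymbol_bessel f]
    filter_upwards [fourier_multiplier (besselSymbol d) (bessel f),
      (memLp_two_besselSymbol hd).coeFn_toLp,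
      Lp.coeFn_lpSMul (r := 1) m (𝓕 (bessel f) : L2Space d)] with ξ h₁ h₂ h₃
    rw [h₁, h₃, Pi.smul_apply', h₂, smul_eq_mul]
  have hnorm : ∫ ξ, ‖(𝓕 (toL2 f) : L2Space d) ξ‖ ≤ ‖m‖ * ‖f‖ := by
    calc ∫ ξ, ‖(𝓕 (toL2 f) : L2Space d) ξ‖ = ‖v‖ := by
          rw [L1.norm_eq_integral_norm]
          exact integral_congr_ae (hv.fun_comp norm)
      _ ≤ ‖m‖ * ‖(𝓕 (bessel f) : L2Space d)‖ := Lp.norm_smul_le _ _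
      _ = ‖m‖ * ‖f‖ := by rw [Lp.norm_fourier_eq, norm_bessel]
  filter_upwards [ae_norm_le_integral_norm_fourier ((L1.integrable_coeFn v).congr hv.symm)]
    with x hx using hx.trans hnorm

end SobolevEmbedding

section SecondDifferences

variable {d : ℕ}

/-- The symbol `ξ ↦ exp(2πi ⟪ξ, h⟫)` of the translation by `h`. -/
def translationSymbol (h : EuclideanSpace ℝ (Fin d)) : Symbol d :=
  BoundedContinuousFunction.char Real.continuous_fourierChar
    (L := innerₗ (EuclideanSpace ℝ (Fin d))) continuous_inner h

theorem translationSymbol_apply (h ξ : EuclideanSpace ℝ (Fin d)) :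
    translationSymbol h ξ = Real.fourierChar ⟪ξ, h⟫ := rfl

theorem multiplier_translationSymbol_toLp (h : EuclideanSpace ℝ (Fin d))
    (g : 𝓢(EuclideanSpace ℝ (Fin d), ℂ)) :
    multiplier (translationSymbol h) (g.toLp 2) = (g.compSubConstCLM ℂ (-h)).toLp 2 := by
  refine multiplierCLM_eq ?_
  rw [SchwartzMap.toLp_fourier_eq, SchwartzMap.toLp_fourier_eq]
  filter_upwards [(𝓕 (g.compSubConstCLM ℂ (-h))).coeFn_toLp 2 volume,
    (𝓕 g).coeFn_toLp 2 volume] with ξ h₁ h₂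
  have hg : (g.compSubConstCLM ℂ (-h) : EuclideanSpace ℝ (Fin d) → ℂ) = g ∘ fun v => v + h := by
    ext x
    simp
  rw [h₁, h₂, SchwartzMap.fourier_coe, SchwartzMap.fourier_coe, hg,
    translationSymbol_apply, real_inner_comm]
  exact congrFun (VectorFourier.fourierIntegral_comp_add_right Real.fourierChar volume
    (innerₗ (EuclideanSpace ℝ (Fin d))) g h) ξ

theorem multiplier_translationSymbol_eq (h : EuclideanSpace ℝ (Fin d)) (f : L2Space d) :
    multiplier (translationSymbol h) f =
      Lp.compMeasurePreserving (fun x => x + h) (measurePreserving_add_right volume h) f := by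
  refine DenseRange.induction_on
    (p := fun f => multiplier (translationSymbol h) f = Lp.compMeasurePreserving _ _ f)
    (SchwartzMap.denseRange_toLpCLM (p := 2) ENNReal.ofNat_ne_top) f
    (isClosed_eq (multiplier _).continuous
      (Lp.isometry_compMeasurePreserving (measurePreserving_add_right volume h)).continuous)
    fun g => ?_
  refine (multiplier_translationSymbol_toLp h g).trans (Lp.ext ?_)
  filter_upwards [(g.compSubConstCLM ℂ (-h)).coeFn_toLp 2 volume,
    Lp.coeFn_compMeasurePreserving (g.toLp 2) (measurePreserving_add_right volume h),
    (measurePreserving_add_right volume h).quasiMeasurePreserving.ae (g.coeFn_toLp 2 volume)]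
    with x h₁ h₂ h₃
  refine h₁.trans (Eq.trans ?_ (h₂.trans h₃).symm)
  simp

theorem coeFn_multiplier_translationSymbol (h : EuclideanSpace ℝ (Fin d)) (f : L2Space d) :
    multiplier (translationSymbol h) f =ᵐ[volume] fun x => f (x + h) := by
  rw [multiplier_translationSymbol_eq]
  exact Lp.coeFn_compMeasurePreserving _ _

/-- The symbol of the symmetric second difference with step `h`. -/
def secondDiffSymbol (h : EuclideanSpace ℝ (Fin d)) : Symbol d :=
  translationSymbol h - (2 : ℂ) • 1 + translationSymbol (-h)

/-- The symmetric second difference `f(· + h) - 2 f + f(· - h)` with step `h`, as a bounded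
operator on `L²`. -/
def secondDiff (h : EuclideanSpace ℝ (Fin d)) : L2Space d →L[ℂ] L2Space d :=
  multiplier (secondDiffSymbol h)

theorem coeFn_secondDiff (h : EuclideanSpace ℝ (Fin d)) (f : L2Space d) :
    secondDiff h f =ᵐ[volume] fun x => f (x + h) - (2 : ℝ) • f x + f (x - h) := by
  have e : secondDiff h f = multiplier (translationSymbol h) f - (2 : ℂ) • f +
      multiplier (translationSymbol (-h)) f := by
    simp only [secondDiff, secondDiffSymbol, map_add, map_sub, map_smul, map_one, add_apply,
      sub_apply, smul_apply, one_apply_eq_self]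
  rw [e]
  filter_upwards [Lp.coeFn_add (multiplier (translationSymbol h) f - (2 : ℂ) • f)
      (multiplier (translationSymbol (-h)) f),
    Lp.coeFn_sub (multiplier (translationSymbol h) f) ((2 : ℂ) • f), Lp.coeFn_smul (2 : ℂ) f,
    coeFn_multiplier_translationSymbol h f,
    coeFn_multiplier_translationSymbol (-h) f] with x h₁ h₂ h₃ h₄ h₅
  rw [h₁, Pi.add_apply, h₂, Pi.sub_apply, h₃, Pi.smul_apply, h₄, h₅, ← sub_eq_add_neg]
  simp

theorem secondDiffSymbol_apply (h ξ : EuclideanSpace ℝ (Fin d)) :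
    secondDiffSymbol h ξ = ((-4 * Real.sin (Real.pi * ⟪ξ, h⟫) ^ 2 : ℝ) : ℂ) := by
  have e : secondDiffSymbol h ξ =
      (Real.fourierChar ⟪ξ, h⟫ : ℂ) - 2 + Real.fourierChar (-⟪ξ, h⟫) := by
    simp [secondDiffSymbol, translationSymbol_apply]
  rw [e, Real.fourierChar_apply, Real.fourierChar_apply, mul_neg]
  push_cast
  rw [sub_add_eq_add_sub, ← Complex.two_cos,
    show (2 * Real.pi * (⟪ξ, h⟫ : ℝ) : ℂ) = 2 * (Real.pi * (⟪ξ, h⟫ : ℝ)) by ring,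
    Complex.cos_two_mul, Complex.cos_sq']
  ring

theorem norm_secondDiffSymbol_le (h ξ : EuclideanSpace ℝ (Fin d)) :
    ‖secondDiffSymbol h ξ‖ ≤ 4 * Real.pi ^ 2 * ‖h‖ ^ 2 * ‖ξ‖ ^ 2 := by
  have hsin : |Real.sin (Real.pi * ⟪ξ, h⟫)| ≤ Real.pi * (‖ξ‖ * ‖h‖) := by
    refine Real.abs_sin_le_abs.trans ?_
    rw [abs_mul, abs_of_pos Real.pi_pos]
    gcongr
    exact abs_real_inner_le_norm ξ h
  calc ‖secondDiffSymbol h ξ‖ = 4 * |Real.sin (Real.pi * ⟪ξ, h⟫)| ^ 2 := by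
        rw [secondDiffSymbol_apply, Complex.norm_real, norm_mul, norm_pow, Real.norm_eq_abs,
          Real.norm_eq_abs, abs_neg, abs_of_pos four_pos]
    _ ≤ 4 * (Real.pi * (‖ξ‖ * ‖h‖)) ^ 2 := by gcongr
    _ = 4 * Real.pi ^ 2 * ‖h‖ ^ 2 * ‖ξ‖ ^ 2 := by ring

theorem norm_secondDiff_le (h : EuclideanSpace ℝ (Fin d)) (f : H2Space d) :
    ‖secondDiff h (toL2 f)‖ ≤ 4 * Real.pi ^ 2 * ‖h‖ ^ 2 * ‖f‖ := by
  have hsymbol : ∀ ξ, ‖(secondDiffSymbol h * besselSymbol d) ξ‖ ≤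
      ‖(((4 * Real.pi ^ 2 * ‖h‖ ^ 2 : ℝ) : ℂ) • (1 : Symbol d)) ξ‖ := by
    intro ξ
    have hξ : ‖besselSymbol d ξ‖ = (1 + ‖ξ‖ ^ 2)⁻¹ := by
      rw [besselSymbol_apply, norm_inv]
      exact_mod_cast congrArg Inv.inv (Complex.norm_of_nonneg (by positivity : 0 ≤ 1 + ‖ξ‖ ^ 2))
    rw [BoundedContinuousFunction.mul_apply, norm_mul, hξ, ← div_eq_mul_inv,
      div_le_iff₀ (by positivity), BoundedContinuousFunction.smul_apply,
      BoundedContinuousFunction.coe_one, Pi.one_apply, smul_eq_mul, mul_one, Complex.norm_real,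
      Real.norm_of_nonneg (by positivity)]
    exact (norm_secondDiffSymbol_le h ξ).trans (by gcongr; linarith)
  calc ‖secondDiff h (toL2 f)‖
      = ‖multiplier (secondDiffSymbol h * besselSymbol d) (bessel f)‖ := by
        rw [multiplier_mul_apply, multiplier_besselSymbol_bessel, secondDiff]
    _ ≤ _ := norm_multiplier_le_norm_multiplier hsymbol _
    _ = 4 * Real.pi ^ 2 * ‖h‖ ^ 2 * ‖f‖ := by
        rw [map_smul, map_one, smul_apply, one_apply_eq_self, norm_smul, norm_bessel,
          Complex.norm_real, Real.norm_of_nonneg (by positivity)]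

theorem tendsto_natCast_add_one_mul_sin_div (x : ℝ) :
    Tendsto (fun n : ℕ => ((n : ℝ) + 1) * Real.sin (x / ((n : ℝ) + 1))) atTop (𝓝 x) := by
  have hsinc : Tendsto (fun n : ℕ => x * Real.sinc (x * (1 / ((n : ℝ) + 1)))) atTop (𝓝 x) := by
    simpa using ((Real.continuous_sinc.tendsto (x * 0)).comp
      ((tendsto_one_div_add_atTop_nhds_zero_nat (𝕜 := ℝ)).const_mul x)).const_mul x
  refine hsinc.congr fun n => ?_
  rcases eq_or_ne x 0 with rfl | hx
  · simp
  · rw [Real.sinc_of_ne_zero (by positivity), mul_one_div]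
    field_simp

/-- The symbol of the rescaled second difference in the `j`-th coordinate direction with step
`1 / (n + 1)`, normalized so as to converge to `ξ_j²`. -/
def coordDiffSymbol (n : ℕ) (j : Fin d) : Symbol d :=
  (-((((n : ℝ) + 1) / (2 * Real.pi)) ^ 2 : ℝ) : ℂ) •
    secondDiffSymbol (EuclideanSpace.single j (1 / ((n : ℝ) + 1)))

theorem tendsto_coordDiffSymbol (j : Fin d) (ξ : EuclideanSpace ℝ (Fin d)) :
    Tendsto (fun n => coordDiffSymbol n j ξ) atTop (𝓝 ((ξ j : ℂ) ^ 2)) := by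
  have hlim := ((tendsto_natCast_add_one_mul_sin_div (Real.pi * ξ j)).div_const Real.pi).pow 2
  rw [mul_div_cancel_left₀ _ Real.pi_ne_zero] at hlim
  have hlim' := (Complex.continuous_ofReal.tendsto _).comp hlim
  rw [Complex.ofReal_pow] at hlim'
  refine hlim'.congr fun n => ?_
  have hinner : ⟪ξ, EuclideanSpace.single j (1 / ((n : ℝ) + 1))⟫ = ξ j / ((n : ℝ) + 1) := by
    rw [EuclideanSpace.inner_single_right]
    simp [div_eq_inv_mul]
  rw [coordDiffSymbol, BoundedContinuousFunction.smul_apply, secondDiffSymbol_apply, hinner,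
    smul_eq_mul, ← Complex.ofReal_neg, ← Complex.ofReal_mul, Function.comp_apply, mul_div_assoc]
  congr 1
  field_simp
  ring

theorem norm_multiplier_coordDiffSymbol_le {f : L2Space d} {K : ℝ}
    (hf : ∀ h, ‖secondDiff h f‖ ≤ 4 * Real.pi ^ 2 * ‖h‖ ^ 2 * K) (n : ℕ) (j : Fin d) :
    ‖multiplier (coordDiffSymbol n j) f‖ ≤ K := by
  have h := hf (EuclideanSpace.single j (1 / ((n : ℝ) + 1)))
  rw [PiLp.norm_single, Real.norm_of_nonneg (by positivity)] at h
  calc ‖multiplier (coordDiffSymbol n j) f‖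
      = (((n : ℝ) + 1) / (2 * Real.pi)) ^ 2 *
          ‖secondDiff (EuclideanSpace.single j (1 / ((n : ℝ) + 1))) f‖ := by
        rw [coordDiffSymbol, map_smul, smul_apply, norm_smul, norm_neg, Complex.norm_real,
          Real.norm_of_nonneg (by positivity), secondDiff]
    _ ≤ _ := mul_le_mul_of_nonneg_left h (by positivity)
    _ = K := by
        field_simp
        ring

theorem mem_H2Ball_of_norm_secondDiff_le {f : L2Space d} {K : ℝ}
    (hf : ∀ h, ‖secondDiff h f‖ ≤ 4 * Real.pi ^ 2 * ‖h‖ ^ 2 * K) :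
    f ∈ H2Ball d (‖f‖ + d * K) := by
  refine mem_H2Ball_of_tendsto_symbol (b := fun n => 1 + ∑ j, coordDiffSymbol n j)
    (fun ξ => ?_) fun n => ?_
  · have hnorm : (‖ξ‖ : ℂ) ^ 2 = ∑ j, (ξ j : ℂ) ^ 2 := by
      exact_mod_cast congrArg Complex.ofReal (EuclideanSpace.real_norm_sq_eq ξ)
    simp only [BoundedContinuousFunction.add_apply, BoundedContinuousFunction.coe_one, Pi.one_apply,
      BoundedContinuousFunction.sum_apply, hnorm]
    exact (tendsto_finsetSum _ fun j _ => tendsto_coordDiffSymbol j ξ).const_add 1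
  · rw [map_add, map_one, map_sum, add_apply, one_apply_eq_self, sum_apply]
    refine (norm_add_le _ _).trans (add_le_add_right ?_ _)
    simpa using norm_sum_le_of_le Finset.univ fun j _ => norm_multiplier_coordDiffSymbol_le hf n j

end SecondDifferences

section DiscreteGagliardoNirenberg

variable {F : Type*} [NormedAddCommGroup F] [InnerProductSpace ℝ F]

theorem norm_norm_sq_smul_sub_le (a b : F) :
    ‖‖b‖ ^ 2 • b - ‖a‖ ^ 2 • a‖ ≤ 3 / 2 * ‖a - b‖ * (‖a‖ ^ 2 + ‖b‖ ^ 2) := by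
  have e : ‖b‖ ^ 2 • b - ‖a‖ ^ 2 • a =
      (1 / 2 : ℝ) • ((‖a‖ ^ 2 + ‖b‖ ^ 2) • (b - a) + (‖b‖ ^ 2 - ‖a‖ ^ 2) • (a + b)) := by
    module
  have hdiff : |‖b‖ ^ 2 - ‖a‖ ^ 2| ≤ ‖a - b‖ * (‖a‖ + ‖b‖) := by
    rw [sq_sub_sq, abs_mul, abs_of_nonneg (by positivity), mul_comm, add_comm ‖b‖, norm_sub_rev]
    gcongr
    exact abs_norm_sub_norm_le b a
  calc ‖‖b‖ ^ 2 • b - ‖a‖ ^ 2 • a‖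
      ≤ 1 / 2 * ((‖a‖ ^ 2 + ‖b‖ ^ 2) * ‖a - b‖ + |‖b‖ ^ 2 - ‖a‖ ^ 2| * ‖a + b‖) := by
        rw [e, norm_smul, Real.norm_of_nonneg (by norm_num : (0 : ℝ) ≤ 1 / 2)]
        refine mul_le_mul_of_nonneg_left ((norm_add_le _ _).trans_eq ?_) (by norm_num)
        rw [norm_smul, norm_smul, Real.norm_of_nonneg (by positivity), Real.norm_eq_abs,
          norm_sub_rev]
    _ ≤ 1 / 2 * ((‖a‖ ^ 2 + ‖b‖ ^ 2) * ‖a - b‖ + ‖a - b‖ * (‖a‖ + ‖b‖) * (‖a‖ + ‖b‖)) := by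
        gcongr
        exact norm_add_le a b
    _ ≤ 3 / 2 * ‖a - b‖ * (‖a‖ ^ 2 + ‖b‖ ^ 2) := by
        nlinarith [mul_nonneg (norm_nonneg (a - b)) (sq_nonneg (‖a‖ - ‖b‖))]

theorem inner_norm_sq_smul_sub_le {K : ℝ} {a b c : F} (hc : ‖c‖ ≤ K) :
    ⟪‖b‖ ^ 2 • b - ‖a‖ ^ 2 • a, c⟫ ≤
      1 / 4 * ‖a‖ ^ 4 + 1 / 4 * ‖b‖ ^ 4 + 9 / 2 * K ^ 2 * ‖a - b‖ ^ 2 := by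
  have hinner : ⟪‖b‖ ^ 2 • b - ‖a‖ ^ 2 • a, c⟫ ≤
      3 / 2 * ‖a - b‖ * (‖a‖ ^ 2 + ‖b‖ ^ 2) * K :=
    (real_inner_le_norm _ _).trans (by gcongr; exact norm_norm_sq_smul_sub_le a b)
  nlinarith [sq_nonneg (3 * K * ‖a - b‖ - ‖a‖ ^ 2), sq_nonneg (3 * K * ‖a - b‖ - ‖b‖ ^ 2)]

variable {X : Type*} [MeasurableSpace X] {μ : Measure X} {K M : ℝ} {u v : X → F}

theorem integrable_inner_of_memLp (hu : MemLp u 2 μ) (hv : MemLp v 2 μ) :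
    Integrable (fun x => ⟪u x, v x⟫) μ := by
  refine (L2.integrable_inner (𝕜 := ℝ) (hu.toLp u) (hv.toLp v)).congr ?_
  filter_upwards [hu.coeFn_toLp, hv.coeFn_toLp] with x h₁ h₂
  rw [h₁, h₂]

theorem memLp_norm_sq_smul (hu : MemLp u 2 μ) (hK : ∀ᵐ x ∂μ, ‖u x‖ ≤ K) :
    MemLp (fun x => ‖u x‖ ^ 2 • u x) 2 μ := by
  refine hu.of_le_mul (c := K ^ 2) ((hu.1.norm.pow 2).smul hu.1) ?_
  filter_upwards [hK] with x hx
  rw [norm_smul, Real.norm_of_nonneg (by positivity)]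
  gcongr

theorem real_inner_norm_sq_smul_self (a : F) : ⟪‖a‖ ^ 2 • a, a⟫ = ‖a‖ ^ 4 := by
  rw [real_inner_smul_left, real_inner_self_eq_norm_sq, ← pow_add]

theorem integrable_norm_pow_four (hu : MemLp u 2 μ) (hK : ∀ᵐ x ∂μ, ‖u x‖ ≤ K) :
    Integrable (fun x => ‖u x‖ ^ 4) μ :=
  (integrable_inner_of_memLp (memLp_norm_sq_smul hu hK) hu).congr
    (ae_of_all _ fun x => real_inner_norm_sq_smul_self (u x))

variable [AddGroup X] [MeasurableAdd X] [μ.IsAddRightInvariant]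

theorem integral_inner_sub_comp_add (hu : MemLp u 2 μ) (hv : MemLp v 2 μ) (h : X) :
    ∫ x, ⟪v x, u (x + h) - u x⟫ ∂μ = ∫ x, ⟪v (x - h) - v x, u x⟫ ∂μ := by
  have hu' : MemLp (fun x => u (x + h)) 2 μ :=
    hu.comp_measurePreserving (measurePreserving_add_right μ h)
  have hv' : MemLp (fun x => v (x - h)) 2 μ :=
    hv.comp_measurePreserving (measurePreserving_sub_right μ h)
  have hshift : ∫ x, ⟪v (x - h), u x⟫ ∂μ = ∫ x, ⟪v x, u (x + h)⟫ ∂μ := by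
    rw [← integral_sub_right_eq_self (fun x => ⟪v x, u (x + h)⟫) h]
    simp only [sub_add_cancel]
  simp only [inner_sub_left, inner_sub_right]
  rw [integral_sub (integrable_inner_of_memLp hv hu') (integrable_inner_of_memLp hv hu),
    integral_sub (integrable_inner_of_memLp hv' hu) (integrable_inner_of_memLp hv hu), hshift]

theorem integral_inner_norm_sq_smul_sub_le (hu : MemLp u 2 μ) (hK : ∀ᵐ x ∂μ, ‖u x‖ ≤ K)
    (hv : MemLp v 2 μ) (hM : ∀ᵐ x ∂μ, ‖v x‖ ≤ M) (h : X) :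
    ∫ x, ⟪‖v (x - h)‖ ^ 2 • v (x - h) - ‖v x‖ ^ 2 • v x, u x⟫ ∂μ ≤
      1 / 2 * ∫ x, ‖v x‖ ^ 4 ∂μ + 9 / 2 * K ^ 2 * ∫ x, ‖v x - v (x - h)‖ ^ 2 ∂μ := by
  have hsub := measurePreserving_sub_right μ h
  have hv3 := memLp_norm_sq_smul hv hM
  have hv4 : Integrable (fun x => 1 / 4 * ‖v x‖ ^ 4) μ :=
    (integrable_norm_pow_four hv hM).const_mul _
  have hv4' : Integrable (fun x => 1 / 4 * ‖v (x - h)‖ ^ 4) μ :=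
    hsub.integrable_comp_of_integrable hv4
  have hvv : Integrable (fun x => 1 / 4 * ‖v x‖ ^ 4 + 1 / 4 * ‖v (x - h)‖ ^ 4) μ := hv4.add hv4'
  have hS : Integrable (fun x => 9 / 2 * K ^ 2 * ‖v x - v (x - h)‖ ^ 2) μ :=
    ((hv.sub (hv.comp_measurePreserving hsub)).integrable_norm_pow two_ne_zero).const_mul _
  calc ∫ x, ⟪‖v (x - h)‖ ^ 2 • v (x - h) - ‖v x‖ ^ 2 • v x, u x⟫ ∂μ
      ≤ ∫ x, (1 / 4 * ‖v x‖ ^ 4 + 1 / 4 * ‖v (x - h)‖ ^ 4 +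
          9 / 2 * K ^ 2 * ‖v x - v (x - h)‖ ^ 2) ∂μ := by
        refine integral_mono_ae (integrable_inner_of_memLp
          ((hv3.comp_measurePreserving hsub).sub hv3) hu) (hvv.add hS) ?_
        filter_upwards [hK] with x hx using inner_norm_sq_smul_sub_le hx
    _ = _ := by
        rw [integral_add hvv hS, integral_add hv4 hv4',
          integral_sub_right_eq_self (fun x => 1 / 4 * ‖v x‖ ^ 4) h, integral_const_mul,
          integral_const_mul]
        ring

omit [InnerProductSpace ℝ F] in
theorem ae_norm_sub_comp_add_le (hK : ∀ᵐ x ∂μ, ‖u x‖ ≤ K) (h : X) :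
    ∀ᵐ x ∂μ, ‖u (x + h) - u x‖ ≤ 2 * K := by
  filter_upwards [hK, (measurePreserving_add_right μ h).quasiMeasurePreserving.ae hK] with x h₁ h₂
  exact (norm_sub_le _ _).trans (by linarith)

/-- A discrete form of the Gagliardo–Nirenberg inequality `‖∇u‖₄² ≤ C ‖u‖_∞ ‖Δu‖₂`. -/
theorem integral_norm_sub_comp_add_pow_four_le (hu : MemLp u 2 μ) (hK : ∀ᵐ x ∂μ, ‖u x‖ ≤ K)
    (h : X) :
    ∫ x, ‖u (x + h) - u x‖ ^ 4 ∂μ ≤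
      9 * K ^ 2 * ∫ x, ‖u (x + h) - (2 : ℝ) • u x + u (x - h)‖ ^ 2 ∂μ := by
  set D : X → F := fun x => u (x + h) - u x with hD
  have hDm : MemLp D 2 μ :=
    (hu.comp_measurePreserving (measurePreserving_add_right μ h)).sub hu
  have hDb : ∀ᵐ x ∂μ, ‖D x‖ ≤ 2 * K := ae_norm_sub_comp_add_le hK h
  have hparts : ∫ x, ‖D x‖ ^ 4 ∂μ =
      ∫ x, ⟪‖D (x - h)‖ ^ 2 • D (x - h) - ‖D x‖ ^ 2 • D x, u x⟫ ∂μ := by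
    rw [← integral_inner_sub_comp_add hu (memLp_norm_sq_smul hDm hDb) h]
    exact integral_congr_ae (ae_of_all _ fun x => (real_inner_norm_sq_smul_self (D x)).symm)
  have hsecond : ∀ x, D x - D (x - h) = u (x + h) - (2 : ℝ) • u x + u (x - h) := by
    intro x
    simp only [hD, sub_add_cancel]
    module
  have habsorb := integral_inner_norm_sq_smul_sub_le hu hK hDm hDb h
  simp only [← hparts, hsecond] at habsorb
  linarith

end DiscreteGagliardoNirenberg

section Nonlinearity

variable {d : ℕ} {q K R : ℝ}

theorem norm_secondDiff_sq (h : EuclideanSpace ℝ (Fin d)) (f : L2Space d) :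
    ‖secondDiff h f‖ ^ 2 = ∫ x, ‖f (x + h) - (2 : ℝ) • f x + f (x - h)‖ ^ 2 := by
  rw [norm_sq_eq_integral]
  refine integral_congr_ae ?_
  filter_upwards [coeFn_secondDiff h f] with x hx
  rw [hx]

theorem norm_secondDiff_sq_le {N : ℂ → ℂ} {A B : ℝ}
    (hN : ∀ a b c, ‖a‖ ≤ K → ‖b‖ ≤ K → ‖c‖ ≤ K → ‖N a - (2 : ℝ) • N b + N c‖ ≤
      A * ‖a - (2 : ℝ) • b + c‖ + B * ‖a - b‖ ^ 2)
    {f g : L2Space d} (hf : ∀ᵐ x, ‖f x‖ ≤ K) (hg : ∀ᵐ x, g x = N (f x))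
    (h : EuclideanSpace ℝ (Fin d)) :
    ‖secondDiff h g‖ ^ 2 ≤ (2 * A ^ 2 + 18 * B ^ 2 * K ^ 2) * ‖secondDiff h f‖ ^ 2 := by
  have hadd := measurePreserving_add_right (volume : Measure (EuclideanSpace ℝ (Fin d))) h
  have hsub := measurePreserving_sub_right (volume : Measure (EuclideanSpace ℝ (Fin d))) h
  have hf2 : Integrable fun x => 2 * A ^ 2 * ‖secondDiff h f x‖ ^ 2 :=
    ((Lp.memLp _).integrable_norm_pow two_ne_zero).const_mul _
  have hD4 : Integrable fun x => 2 * B ^ 2 * ‖f (x + h) - f x‖ ^ 4 :=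
    (integrable_norm_pow_four (((Lp.memLp f).comp_measurePreserving hadd).sub (Lp.memLp f))
      (ae_norm_sub_comp_add_le hf h)).const_mul _
  have hpointwise : ∀ᵐ x, ‖secondDiff h g x‖ ^ 2 ≤
      2 * A ^ 2 * ‖secondDiff h f x‖ ^ 2 + 2 * B ^ 2 * ‖f (x + h) - f x‖ ^ 4 := by
    filter_upwards [coeFn_secondDiff h g, coeFn_secondDiff h f, hf, hg,
      hadd.quasiMeasurePreserving.ae hf, hadd.quasiMeasurePreserving.ae hg,
      hsub.quasiMeasurePreserving.ae hf, hsub.quasiMeasurePreserving.ae hg]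
      with x hSg hSf hf₀ hg₀ hf₁ hg₁ hf₂ hg₂
    rw [hSg, hSf, hg₀, hg₁, hg₂]
    refine (pow_le_pow_left₀ (norm_nonneg _) (hN _ _ _ hf₁ hf₀ hf₂) 2).trans
      (add_sq_le.trans_eq ?_)
    ring
  calc ‖secondDiff h g‖ ^ 2 = ∫ x, ‖secondDiff h g x‖ ^ 2 := norm_sq_eq_integral _
    _ ≤ ∫ x, (2 * A ^ 2 * ‖secondDiff h f x‖ ^ 2 + 2 * B ^ 2 * ‖f (x + h) - f x‖ ^ 4) :=
        integral_mono_ae ((Lp.memLp _).integrable_norm_pow two_ne_zero) (hf2.add hD4) hpointwise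
    _ = 2 * A ^ 2 * ‖secondDiff h f‖ ^ 2 + 2 * B ^ 2 * ∫ x, ‖f (x + h) - f x‖ ^ 4 := by
        rw [integral_add hf2 hD4, integral_const_mul, integral_const_mul, ← norm_sq_eq_integral]
    _ ≤ 2 * A ^ 2 * ‖secondDiff h f‖ ^ 2 + 2 * B ^ 2 * (9 * K ^ 2 * ‖secondDiff h f‖ ^ 2) := by
        rw [norm_secondDiff_sq h f]
        gcongr
        exact integral_norm_sub_comp_add_pow_four_le (Lp.memLp f) hf h
    _ = _ := by ring

theorem memLp_powNL (hq : 0 ≤ q) {f : L2Space d} (hf : ∀ᵐ x, ‖f x‖ ≤ K) :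
    MemLp (fun x => powNL q (f x)) 2 := by
  have hcont : Continuous (powNL q : ℂ → ℂ) :=
    (continuous_norm.rpow_const fun _ => Or.inr hq).smul continuous_id
  refine (Lp.memLp f).of_le_mul (c := K ^ q)
    (hcont.comp_aestronglyMeasurable (Lp.aestronglyMeasurable f)) ?_
  filter_upwards [hf] with x hx
  rw [powNL, norm_smul, Real.norm_of_nonneg (by positivity)]
  gcongr

open Classical in
/-- The nonlinearity `|f|^q f` as a map of `L²`, set to zero where it does not take values in
`L²`. -/
def nonlin (q : ℝ) (f : L2Space d) : L2Space d :=
  if h : MemLp (fun x => powNL q (f x)) 2 volume then h.toLp _ else 0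

theorem coeFn_nonlin (hq : 0 ≤ q) {f : L2Space d} (hf : ∀ᵐ x, ‖f x‖ ≤ K) :
    nonlin q f =ᵐ[volume] fun x => powNL q (f x) := by
  rw [nonlin, dif_pos (memLp_powNL hq hf)]
  exact MemLp.coeFn_toLp _

theorem exists_ae_norm_le_of_mem_H2Ball (hd : d ≤ 3) (R : ℝ) :
    ∃ K, 0 ≤ K ∧ ∀ f ∈ H2Ball d R, ∀ᵐ x, ‖f x‖ ≤ K := by
  obtain ⟨C, hC, h⟩ := exists_ae_norm_toL2_le hd
  refine ⟨C * |R|, by positivity, ?_⟩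
  rintro _ ⟨f, hf, rfl⟩
  filter_upwards [h f] with x hx
  exact hx.trans (by gcongr; exact (mem_closedBall_zero_iff.1 hf).trans (le_abs_self R))

theorem exists_lipschitzOnWith_nonlin (hd : d ≤ 3) (hq : 1 ≤ q) (R : ℝ) :
    ∃ L : ℝ≥0, LipschitzOnWith L (nonlin q) (H2Ball d R) := by
  obtain ⟨K, hK, h⟩ := exists_ae_norm_le_of_mem_H2Ball hd R
  refine ⟨_, LipschitzOnWith.of_dist_le_mul
    (K := ((q + 1) * K ^ q).toNNReal) fun f hf g hg => ?_⟩
  rw [dist_eq_norm, dist_eq_norm]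
  refine Lp.norm_le_mul_norm_of_ae_le_mul ?_
  filter_upwards [Lp.coeFn_sub (nonlin q f) (nonlin q g), Lp.coeFn_sub f g, h f hf, h g hg,
    coeFn_nonlin (by positivity) (h f hf), coeFn_nonlin (by positivity) (h g hg)]
    with x hNfg hfg hfK hgK hNf hNg
  rw [hNfg, hfg, Pi.sub_apply, Pi.sub_apply, hNf, hNg]
  exact (lipschitzOnWith_powNL hq hK).norm_sub_le (mem_closedBall_zero_iff.2 hfK)
    (mem_closedBall_zero_iff.2 hgK)

theorem norm_nonlin_le (hq : 0 ≤ q) {f : L2Space d} (hf : ∀ᵐ x, ‖f x‖ ≤ K) :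
    ‖nonlin q f‖ ≤ K ^ q * ‖f‖ := by
  refine Lp.norm_le_mul_norm_of_ae_le_mul ?_
  filter_upwards [coeFn_nonlin hq hf, hf] with x hx hxK
  rw [hx, powNL, norm_smul, Real.norm_of_nonneg (by positivity)]
  gcongr

theorem exists_norm_secondDiff_nonlin_le (hq : 1 ≤ q) (K : ℝ) :
    ∃ C, 0 ≤ C ∧ ∀ f : L2Space d, (∀ᵐ x, ‖f x‖ ≤ K) →
      ∀ h, ‖secondDiff h (nonlin q f)‖ ≤ C * ‖secondDiff h f‖ := by
  refine ⟨√(2 * ((q + 1) * (3 * K) ^ q) ^ 2 +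
    18 * (q * (2 * q + 5) * (3 * K) ^ (q - 1)) ^ 2 * K ^ 2), Real.sqrt_nonneg _, fun f hf h => ?_⟩
  rw [← abs_of_nonneg (norm_nonneg (secondDiff h f)), ← Real.sqrt_sq_eq_abs,
    ← Real.sqrt_mul (by positivity)]
  exact Real.le_sqrt_of_sq_le (norm_secondDiff_sq_le
    (fun a b c => norm_powNL_second_diff_le hq) hf (coeFn_nonlin (by positivity) hf) h)

theorem exists_mapsTo_nonlin_H2Ball (hd : d ≤ 3) (hq : 1 ≤ q) (R : ℝ) :
    ∃ C, 0 ≤ C ∧ MapsTo (nonlin q) (H2Ball d R) (H2Ball d C) := by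
  obtain ⟨K, hK, hS⟩ := exists_ae_norm_le_of_mem_H2Ball hd R
  obtain ⟨C, hC, hN⟩ := exists_norm_secondDiff_nonlin_le (d := d) hq K
  refine ⟨K ^ q * |R| + d * (C * |R|), by positivity, ?_⟩
  rintro _ ⟨f, hf, rfl⟩
  have hfK := hS _ (mem_image_of_mem _ hf)
  have hfR : ‖f‖ ≤ |R| := (mem_closedBall_zero_iff.1 hf).trans (le_abs_self R)
  refine H2Ball_mono ?_ (mem_H2Ball_of_norm_secondDiff_le (K := C * |R|) fun h => ?_)
  · gcongr
    exact (norm_nonlin_le (by positivity) hfK).trans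
      (by gcongr; exact (norm_toL2_le f).trans hfR)
  · calc ‖secondDiff h (nonlin q (toL2 f))‖ ≤ C * (4 * Real.pi ^ 2 * ‖h‖ ^ 2 * ‖f‖) :=
          (hN _ hfK h).trans (by gcongr; exact norm_secondDiff_le h f)
      _ ≤ C * (4 * Real.pi ^ 2 * ‖h‖ ^ 2 * |R|) := by gcongr
      _ = _ := by ring

end Nonlinearity

section Schrodinger

variable {d : ℕ}

/-- The symbol `exp(-4π² i a |ξ|²)` of the free Schrödinger propagator. -/
def phase (a : ℝ) : Symbol d :=
  BoundedContinuousFunction.ofNormedAddCommGroup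
    (fun ξ => Complex.exp (((-(a * ((2 * Real.pi) ^ 2 * ‖ξ‖ ^ 2)) : ℝ) : ℂ) * Complex.I))
    (by fun_prop) 1 fun ξ => (Complex.norm_exp_ofReal_mul_I _).le

theorem phase_apply (a : ℝ) (ξ : EuclideanSpace ℝ (Fin d)) :
    phase a ξ = Complex.exp (((-(a * ((2 * Real.pi) ^ 2 * ‖ξ‖ ^ 2)) : ℝ) : ℂ) * Complex.I) := rfl

theorem norm_phase (a : ℝ) (ξ : EuclideanSpace ℝ (Fin d)) : ‖phase a ξ‖ = 1 :=
  Complex.norm_exp_ofReal_mul_I _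

theorem phase_zero : (phase 0 : Symbol d) = 1 := by
  ext ξ
  simp [phase_apply]

theorem phase_add (a b : ℝ) : (phase (a + b) : Symbol d) = phase a * phase b := by
  ext ξ
  rw [BoundedContinuousFunction.mul_apply, phase_apply, phase_apply, phase_apply,
    ← Complex.exp_add]
  push_cast
  ring_nf

theorem hasDerivAt_phase (a : ℝ) (ξ : EuclideanSpace ℝ (Fin d)) :
    HasDerivAt (phase · ξ) (-(((2 * Real.pi) ^ 2 * ‖ξ‖ ^ 2 : ℝ) : ℂ) * Complex.I * phase a ξ)
      a := by
  refine ((hasDerivAt_mul_const ((2 * Real.pi) ^ 2 * ‖ξ‖ ^ 2)).fun_neg.ofReal_comp.mul_const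
    Complex.I).cexp.congr_deriv ?_
  rw [phase_apply]
  push_cast
  ring

theorem norm_phase_sub_le (s a : ℝ) (ξ : EuclideanSpace ℝ (Fin d)) :
    ‖phase s ξ - phase a ξ‖ ≤ (2 * Real.pi) ^ 2 * ‖ξ‖ ^ 2 * ‖s - a‖ :=
  convex_univ.norm_image_sub_le_of_norm_hasDerivWithin_le
    (fun r _ => (hasDerivAt_phase r ξ).hasDerivWithinAt)
    (fun r _ => by
      rw [norm_mul, norm_mul, norm_phase, Complex.norm_I, norm_neg, Complex.norm_real, mul_one,
        mul_one, Real.norm_of_nonneg (by positivity)])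
    (mem_univ a) (mem_univ s)

/-- The free Schrödinger propagator `exp(i a Δ)` on `L²`. -/
def schro (a : ℝ) : L2Space d →L[ℂ] L2Space d := multiplier (phase a)

theorem schro_zero (f : L2Space d) : schro 0 f = f := by
  rw [schro, phase_zero, map_one, one_apply_eq_self]

theorem schro_schro (a b : ℝ) (f : L2Space d) : schro a (schro b f) = schro (a + b) f := by
  rw [schro, schro, schro, phase_add, multiplier_mul_apply]

theorem schro_neg_schro (a : ℝ) (f : L2Space d) : schro (-a) (schro a f) = f := by
  rw [schro_schro, neg_add_cancel, schro_zero]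

theorem schro_schro_neg (a : ℝ) (f : L2Space d) : schro a (schro (-a) f) = f := by
  rw [schro_schro, add_neg_cancel, schro_zero]

theorem norm_schro (a : ℝ) (f : L2Space d) : ‖schro a f‖ = ‖f‖ := by
  have hle : ∀ b (g : L2Space d), ‖schro b g‖ ≤ ‖g‖ := fun b g => by
    have h := norm_multiplier_le_norm_multiplier (b := phase b) (c := 1)
      (fun ξ => ((norm_phase b ξ).trans norm_one.symm).le) g
    rwa [map_one, one_apply_eq_self] at h
  refine (hle a f).antisymm ?_
  simpa only [schro_neg_schro] using hle (-a) (schro a f)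

theorem continuous_schro (f : L2Space d) : Continuous (schro · f) :=
  continuous_iff_continuousAt.2 fun a =>
    tendsto_multiplier (Eventually.of_forall fun s ξ => (norm_phase s ξ).le)
      (fun ξ => (hasDerivAt_phase a ξ).continuousAt) f

theorem tendsto_schro {ι : Type*} {l : Filter ι} {a : ι → ℝ} {a₀ : ℝ} {f : ι → L2Space d}
    {f₀ : L2Space d} (ha : Tendsto a l (𝓝 a₀)) (hf : Tendsto f l (𝓝 f₀)) :
    Tendsto (fun i => schro (a i) (f i)) l (𝓝 (schro a₀ f₀)) := by
  have hdiff : Tendsto (fun i => schro (a i) (f i - f₀)) l (𝓝 0) := by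
    rw [tendsto_zero_iff_norm_tendsto_zero]
    simpa only [norm_schro] using tendsto_iff_norm_sub_tendsto_zero.1 hf
  simpa using hdiff.add (((continuous_schro f₀).tendsto a₀).comp ha)

theorem hasDerivAt_multiplier {b : ℝ → Symbol d} {b' : Symbol d} {a C : ℝ}
    (hb : ∀ s ξ, ‖b s ξ - b a ξ‖ ≤ C * ‖s - a‖) (hb' : ∀ ξ, HasDerivAt (b · ξ) (b' ξ) a)
    (f : L2Space d) : HasDerivAt (fun s => multiplier (b s) f) (multiplier b' f) a := by
  rw [hasDerivAt_iff_tendsto_slope]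
  have hslope : ∀ s, slope (fun s => multiplier (b s) f) a s =
      multiplier ((((s - a)⁻¹ : ℝ) : ℂ) • (b s - b a)) f := fun s => by
    rw [slope_def_module, map_smul, map_sub]
    rfl
  simp only [funext hslope]
  refine tendsto_multiplier (C := C) ?_ (fun ξ => ?_) f
  · filter_upwards [self_mem_nhdsWithin] with s hs ξ
    rw [BoundedContinuousFunction.smul_apply, norm_smul, Complex.norm_real, norm_inv,
      inv_mul_le_iff₀ (norm_pos_iff.2 (sub_ne_zero.2 hs)), mul_comm]
    exact hb s ξ
  · refine (hasDerivAt_iff_tendsto_slope.1 (hb' ξ)).congr fun s => ?_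
    rw [slope_def_module]
    rfl

theorem hasDerivAt_schro (a : ℝ) (f : H2Space d) :
    HasDerivAt (fun s => schro s (toL2 f)) (Complex.I • schro a (laplace f)) a := by
  have hschro : ∀ s, multiplier (phase s * besselSymbol d) (bessel f) = schro s (toL2 f) :=
    fun s => by rw [multiplier_mul_apply, multiplier_besselSymbol_bessel, schro]
  have hlaplace : multiplier
      ((Complex.I * ((2 * Real.pi) ^ 2 : ℝ)) • (phase a * (besselSymbol d - 1))) (bessel f) =
        Complex.I • schro a (laplace f) := by
    rw [map_smul, smul_apply, multiplier_mul_apply, map_sub, map_one, sub_apply,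
      one_apply_eq_self, multiplier_besselSymbol_bessel, laplace_eq, map_smul, smul_smul, schro]
  rw [← hlaplace]
  simp only [← hschro]
  refine hasDerivAt_multiplier (C := (2 * Real.pi) ^ 2) (fun s ξ => ?_) (fun ξ => ?_) (bessel f)
  · have hξ : ‖ξ‖ ^ 2 * ‖besselSymbol d ξ‖ ≤ 1 := by
      rw [besselSymbol_apply, norm_inv, ← Complex.ofReal_pow, ← Complex.ofReal_one,
        ← Complex.ofReal_add, Complex.norm_real, Real.norm_of_nonneg (by positivity),
        mul_inv_le_iff₀ (by positivity)]
      linarith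
    calc ‖phase s ξ * besselSymbol d ξ - phase a ξ * besselSymbol d ξ‖
        = ‖phase s ξ - phase a ξ‖ * ‖besselSymbol d ξ‖ := by
          rw [← sub_mul, norm_mul]
      _ ≤ (2 * Real.pi) ^ 2 * ‖ξ‖ ^ 2 * ‖s - a‖ * ‖besselSymbol d ξ‖ := by
          gcongr
          exact norm_phase_sub_le s a ξ
      _ = (2 * Real.pi) ^ 2 * ‖s - a‖ * (‖ξ‖ ^ 2 * ‖besselSymbol d ξ‖) := by ring
      _ ≤ (2 * Real.pi) ^ 2 * ‖s - a‖ := mul_le_of_le_one_right (by positivity) hξ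
  · refine ((hasDerivAt_phase a ξ).mul_const (besselSymbol d ξ)).congr_deriv ?_
    change _ = Complex.I * ((2 * Real.pi) ^ 2 : ℝ) * (phase a ξ * (besselSymbol d ξ - 1))
    rw [besselSymbol_apply]
    have := one_add_normSq_ne_zero ξ
    push_cast
    field_simp
    ring

theorem hasDerivAt_schro_comp {a : ℝ → ℝ} {z : ℝ → L2Space d} {a' t : ℝ} {z' : L2Space d}
    {f : H2Space d} (ha : HasDerivAt a a' t) (hz : HasDerivAt z z' t) (hf : z t = toL2 f) :
    HasDerivAt (fun s => schro (a s) (z s))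
      (schro (a t) z' + (a' : ℂ) • Complex.I • schro (a t) (laplace f)) t := by
  have hvar : HasDerivAt (fun s => schro (a s) (z s - z t)) (schro (a t) z') t := by
    rw [hasDerivAt_iff_tendsto_slope] at hz ⊢
    refine (tendsto_schro (ha.continuousAt.tendsto.mono_left nhdsWithin_le_nhds) hz).congr
      fun s => ?_
    rw [slope_def_module, slope_def_module, sub_self, map_zero, sub_zero,
      ContinuousLinearMap.map_smul_of_tower]
  have hfix : HasDerivAt (fun s => schro (a s) (z t))
      ((a' : ℂ) • Complex.I • schro (a t) (laplace f)) t := by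
    rw [hf]
    exact (hasDerivAt_schro (a t) f).scomp t ha
  refine (hvar.add hfix).congr_of_eventuallyEq (Eventually.of_forall fun s => ?_)
  rw [Pi.add_apply, ← map_add, sub_add_cancel]

/-- The free Schrödinger propagator `exp(i a Δ)` on `H²`. -/
def schroH2 (a : ℝ) (f : H2Space d) : H2Space d := (besselEquiv d).symm (schro a (bessel f))

theorem bessel_schroH2 (a : ℝ) (f : H2Space d) : bessel (schroH2 a f) = schro a (bessel f) :=
  bessel_besselEquiv_symm _

theorem toL2_schroH2 (a : ℝ) (f : H2Space d) : toL2 (schroH2 a f) = schro a (toL2 f) := by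
  rw [schroH2, toL2_besselEquiv_symm, schro, multiplier_comm, multiplier_besselSymbol_bessel]

theorem laplace_schroH2 (a : ℝ) (f : H2Space d) :
    laplace (schroH2 a f) = schro a (laplace f) := by
  rw [laplace_eq, laplace_eq, toL2_schroH2, bessel_schroH2, map_smul, map_sub]

theorem norm_schroH2 (a : ℝ) (f : H2Space d) : ‖schroH2 a f‖ = ‖f‖ := by
  rw [← norm_bessel, bessel_schroH2, norm_schro, norm_bessel]

theorem tendsto_schroH2 {ι : Type*} {l : Filter ι} {a : ι → ℝ} {a₀ : ℝ} {f : ι → H2Space d}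
    {f₀ : H2Space d} (ha : Tendsto a l (𝓝 a₀)) (hf : Tendsto f l (𝓝 f₀)) :
    Tendsto (fun i => schroH2 (a i) (f i)) l (𝓝 (schroH2 a₀ f₀)) :=
  ((besselEquiv d).symm.continuous.tendsto _).comp <|
    tendsto_schro ha (((besselEquiv d).continuous.tendsto f₀).comp hf)

theorem schro_mem_H2Ball {R : ℝ} {f : L2Space d} (a : ℝ) (hf : f ∈ H2Ball d R) :
    schro a f ∈ H2Ball d R := by
  obtain ⟨g, hg, rfl⟩ := hf
  rw [← toL2_schroH2, toL2_mem_H2Ball_iff, norm_schroH2]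
  exact mem_closedBall_zero_iff.1 hg

end Schrodinger

section Picard

variable {E : Type*} [NormedAddCommGroup E] [NormedSpace ℝ E] {v : ℝ → E → E} {S : Set E}
  {L : ℝ≥0} {t₀ T : ℝ}

theorem dist_integral_le_of_lipschitzOnWith (hlip : ∀ t, LipschitzOnWith L (v t) S)
    {z w : ℝ → E} (hz : Continuous fun s => v s (z s)) (hw : Continuous fun s => v s (w s))
    (hzS : ∀ s, z s ∈ S) (hwS : ∀ s, w s ∈ S) {D : ℝ} (hD : ∀ s, dist (z s) (w s) ≤ D) {t : ℝ}
    (ht : t ∈ Icc t₀ T) :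
    dist (∫ s in t₀..t, v s (z s)) (∫ s in t₀..t, v s (w s)) ≤ L * (T - t₀) * D := by
  have hvzw : ∀ s, ‖v s (z s) - v s (w s)‖ ≤ L * D := fun s => by
    rw [← dist_eq_norm]
    exact ((hlip s).dist_le_mul _ (hzS s) _ (hwS s)).trans (by gcongr; exact hD s)
  rw [dist_eq_norm, ← intervalIntegral.integral_sub (hz.intervalIntegrable _ _)
    (hw.intervalIntegrable _ _)]
  refine (intervalIntegral.norm_integral_le_of_norm_le_const fun s _ => hvzw s).trans ?_
  have hD₀ : 0 ≤ D := dist_nonneg.trans (hD t)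
  rw [abs_of_nonneg (sub_nonneg.2 ht.1), mul_right_comm]
  gcongr
  exact ht.2

theorem exists_integral_solution [CompleteSpace E] {x₀ : E} (hS : IsClosed S) (hx₀ : x₀ ∈ S)
    (hT : t₀ ≤ T) (hLT : L * (T - t₀) ≤ 1 / 2) (hlip : ∀ t, LipschitzOnWith L (v t) S)
    (hcont : ContinuousOn (Function.uncurry v) (univ ×ˢ S))
    (hmaps : ∀ z : ℝ → E, Continuous z → (∀ t, z t ∈ S) →
      ∀ t ∈ Icc t₀ T, x₀ + ∫ s in t₀..t, v s (z s) ∈ S) :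
    ∃ z : ℝ → E, Continuous z ∧ (∀ t, z t ∈ S) ∧
      ∀ t ∈ Icc t₀ T, z t = x₀ + ∫ s in t₀..t, v s (z s) := by
  let ext (z : C(Icc t₀ T, S)) (s : ℝ) : E := z (projIcc t₀ T hT s)
  have hextS : ∀ z s, ext z s ∈ S := fun z s => (z _).2
  have hext : ∀ z, Continuous (ext z) := fun z =>
    continuous_subtype_val.comp (z.continuous.comp continuous_projIcc)
  have hfield : ∀ z, Continuous fun s => v s (ext z s) := fun z =>
    hcont.comp_continuous (continuous_id.prodMk (hext z)) fun s => ⟨mem_univ s, hextS z s⟩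
  let Φ (z : C(Icc t₀ T, S)) : C(Icc t₀ T, S) :=
    ⟨fun t => ⟨x₀ + ∫ s in t₀..t, v s (ext z s), hmaps _ (hext z) (hextS z) t t.2⟩,
      (continuous_const.add <| (intervalIntegral.continuous_primitive
        (fun a b => (hfield z).intervalIntegrable a b) t₀).comp
          continuous_subtype_val).subtype_mk _⟩
  have hΦ : ContractingWith (1 / 2) Φ := by
    refine ⟨NNReal.half_lt_self one_ne_zero, LipschitzWith.of_dist_le_mul fun z w =>
      (ContinuousMap.dist_le (by positivity)).2 fun t => ?_⟩
    calc dist (Φ z t) (Φ w t)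
        = dist (∫ s in t₀..t, v s (ext z s)) (∫ s in t₀..t, v s (ext w s)) := dist_add_left _ _ _
      _ ≤ L * (T - t₀) * dist z w :=
          dist_integral_le_of_lipschitzOnWith hlip (hfield z) (hfield w) (hextS z) (hextS w)
            (fun _ => ContinuousMap.dist_apply_le_dist (f := z) (g := w) _) t.2
      _ ≤ (1 / 2 : ℝ≥0) * dist z w := by
          push_cast
          gcongr
  have : CompleteSpace S := hS.completeSpace_coe
  have : Nonempty C(Icc t₀ T, S) := ⟨ContinuousMap.const _ ⟨x₀, hx₀⟩⟩
  refine ⟨ext hΦ.fixedPoint, hext _, hextS _, fun t ht => ?_⟩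
  have hfix := DFunLike.congr_fun hΦ.fixedPoint_isFixedPt ⟨t, ht⟩
  have hext_t : ext (ContractingWith.fixedPoint Φ hΦ) t =
      ContractingWith.fixedPoint Φ hΦ ⟨t, ht⟩ := by
    simp only [ext, projIcc_of_mem hT ht]
  exact hext_t.trans (congrArg Subtype.val hfix).symm

end Picard

section Duhamel

variable {d : ℕ} {q R : ℝ} {a : ℝ → ℝ}

/-- A curve of `H²` in the interaction picture, i.e. with the free evolution along `a` undone. -/
def interaction (a : ℝ → ℝ) (u : ℝ → H2Space d) (t : ℝ) : L2Space d :=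
  schro (-a t) (toL2 (u t))

/-- The vector field that governs the equation in the interaction picture. -/
def interactionField (q : ℝ) (a : ℝ → ℝ) (t : ℝ) (z : L2Space d) : L2Space d :=
  Complex.I • schro (-a t) (nonlin q (schro (a t) z))

theorem schro_interaction (a : ℝ → ℝ) (u : ℝ → H2Space d) (t : ℝ) :
    schro (a t) (interaction a u t) = toL2 (u t) :=
  schro_schro_neg _ _

theorem lipschitzOnWith_interactionField {L : ℝ≥0}
    (h : LipschitzOnWith L (nonlin q) (H2Ball d R)) (t : ℝ) :
    LipschitzOnWith L (interactionField q a t) (H2Ball d R) := by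
  refine LipschitzOnWith.of_dist_le_mul fun z hz w hw => ?_
  rw [interactionField, interactionField, dist_smul₀, Complex.norm_I, one_mul, dist_eq_norm,
    ← map_sub, norm_schro, ← dist_eq_norm]
  refine (h.dist_le_mul _ (schro_mem_H2Ball _ hz) _ (schro_mem_H2Ball _ hw)).trans_eq ?_
  rw [dist_eq_norm, ← map_sub, norm_schro, ← dist_eq_norm]

theorem mapsTo_interactionField {C : ℝ}
    (h : MapsTo (nonlin q) (H2Ball d R) (H2Ball d C)) (t : ℝ) :
    MapsTo (interactionField q a t) (H2Ball d R) (H2Ball d C) := fun _ hz =>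
  smul_mem_H2Ball Complex.norm_I.le (schro_mem_H2Ball _ (h (schro_mem_H2Ball _ hz)))

theorem continuousOn_interactionField (h : ContinuousOn (nonlin q) (H2Ball d R))
    (ha : Continuous a) :
    ContinuousOn (Function.uncurry (interactionField q a)) (univ ×ˢ H2Ball d R) := by
  have hschro : ContinuousOn (fun x : ℝ × L2Space d => schro (a x.1) x.2) (univ ×ˢ H2Ball d R) :=
    fun x _ => tendsto_schro (ha.tendsto _ |>.comp continuous_fst.continuousWithinAt)
      continuous_snd.continuousWithinAt
  have hnonlin := h.comp hschro fun x hx => schro_mem_H2Ball _ hx.2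
  exact fun x hx => (tendsto_schro (ha.neg.tendsto _ |>.comp continuous_fst.continuousWithinAt)
    (hnonlin x hx)).const_smul Complex.I

theorem continuousOn_of_toL2_eq_integral {F : ℝ → L2Space d} {C t₀ T : ℝ} (hF : Continuous F)
    (hFC : ∀ s, F s ∈ H2Ball d C) {y : ℝ → H2Space d} {ψ : L2Space d}
    (hy : ∀ t ∈ Icc t₀ T, toL2 (y t) = ψ + ∫ s in t₀..t, F s) : ContinuousOn y (Icc t₀ T) := by
  have hle : ∀ s ∈ Icc t₀ T, ∀ t ∈ Icc t₀ T, s ≤ t → dist (y t) (y s) ≤ C * (t - s) := by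
    intro s hs t ht hst
    rw [dist_eq_norm, ← toL2_mem_H2Ball_iff, map_sub, hy t ht, hy s hs, add_sub_add_left_eq_sub,
      intervalIntegral.integral_interval_sub_left (hF.intervalIntegrable _ _)
        (hF.intervalIntegrable _ _)]
    exact integral_mem_H2Ball hst (hF.intervalIntegrable _ _) fun r _ => hFC r
  refine LipschitzOnWith.continuousOn (K := C.toNNReal) <| LipschitzOnWith.of_dist_le_mul
    fun s hs t ht => (?_ : dist (y s) (y t) ≤ C * dist s t).trans
      (by gcongr; exact Real.le_coe_toNNReal C)
  rcases le_total s t with h | h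
  · rw [dist_comm, dist_comm s, Real.dist_eq, abs_of_nonneg (sub_nonneg.2 h)]
    exact hle s hs t ht h
  · rw [Real.dist_eq, abs_of_nonneg (sub_nonneg.2 h)]
    exact hle t ht s hs h

theorem interaction_mem_H2Ball {u : ℝ → H2Space d} {t : ℝ} (h : ‖u t‖ ≤ R) :
    interaction a u t ∈ H2Ball d R :=
  schro_mem_H2Ball _ (toL2_mem_H2Ball_iff.2 h)

theorem continuous_toL2 : Continuous (toL2 (d := d)) :=
  AddMonoidHomClass.continuous_of_bound toL2 1 fun f => by simpa using norm_toL2_le f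

theorem continuousOn_interaction (ha : Continuous a) {u : ℝ → H2Space d} {K : Set ℝ}
    (hu : ContinuousOn u K) : ContinuousOn (interaction a u) K := fun s hs =>
  tendsto_schro ha.neg.continuousWithinAt
    (continuous_toL2.continuousAt.comp_continuousWithinAt (hu s hs))

theorem continuousOn_interactionField_interaction (hd : d ≤ 3) (hq : 1 ≤ q) (ha : Continuous a)
    {u : ℝ → H2Space d} {K : Set ℝ} (hK : IsCompact K) (hu : ContinuousOn u K) :
    ContinuousOn (fun s => interactionField q a s (interaction a u s)) K := by
  obtain ⟨R, hR⟩ := hK.exists_bound_of_continuousOn hu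
  obtain ⟨L, hL⟩ := exists_lipschitzOnWith_nonlin hd hq R
  exact (continuousOn_interactionField hL.continuousOn ha).comp
    (f := fun s => (s, interaction a u s)) (continuousOn_id.prodMk (continuousOn_interaction ha hu))
    fun s hs => ⟨mem_univ s, interaction_mem_H2Ball (hR s hs)⟩

/-- Solutions of the equation in the integral form of Duhamel, where `a` is a primitive of the
dispersion coefficient. -/
structure IsMildOn (q : ℝ) (a : ℝ → ℝ) (t₀ : ℝ) (φ : H2Space d) (T : ℝ)
    (u : ℝ → H2Space d) : Prop where
  continuousOn : ContinuousOn u (Icc t₀ T)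
  duhamel : ∀ t ∈ Icc t₀ T, interaction a u t = schro (-a t₀) (toL2 φ) +
    ∫ s in t₀..t, interactionField q a s (interaction a u s)

theorem exists_isMildOn_of_integral_solution {C t₀ T : ℝ} (ha : Continuous a)
    (hq : ContinuousOn (nonlin q) (H2Ball d R))
    (hC : MapsTo (nonlin q) (H2Ball d R) (H2Ball d C)) {φ : H2Space d} {z : ℝ → L2Space d}
    (hz : Continuous z) (hzR : ∀ t, z t ∈ H2Ball d R) (hint : ∀ t ∈ Icc t₀ T,
      z t = schro (-a t₀) (toL2 φ) + ∫ s in t₀..t, interactionField q a s (z s)) :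
    ∃ u, IsMildOn q a t₀ φ T u := by
  choose y hy using fun t => (mem_image _ _ _).1 (hzR t)
  have hu : interaction a (fun t => schroH2 (a t) (y t)) = z := by
    ext1 t
    rw [interaction, toL2_schroH2, schro_neg_schro, (hy t).2]
  have hy_cont : ContinuousOn y (Icc t₀ T) := continuousOn_of_toL2_eq_integral
    ((continuousOn_interactionField hq ha).comp_continuous (continuous_id.prodMk hz) fun s =>
      ⟨mem_univ s, hzR s⟩)
    (fun s => mapsTo_interactionField hC s (hzR s)) fun t ht => (hy t).2.trans (hint t ht)
  exact ⟨fun t => schroH2 (a t) (y t),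
    fun t ht => tendsto_schroH2 ha.continuousWithinAt (hy_cont t ht), by rwa [hu]⟩

theorem exists_isMildOn (hd : d ≤ 3) (hq : 1 ≤ q) (M : ℝ) :
    ∃ δ : ℝ, 0 < δ ∧ ∀ a : ℝ → ℝ, Continuous a → ∀ (t₀ : ℝ) (φ : H2Space d), ‖φ‖ ≤ M →
      ∃ u : ℝ → H2Space d, IsMildOn q a t₀ φ (t₀ + δ) u := by
  obtain ⟨C, hC₀, hC⟩ := exists_mapsTo_nonlin_H2Ball hd hq (M + 1)
  obtain ⟨L, hL⟩ := exists_lipschitzOnWith_nonlin hd hq (M + 1)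
  have hδ : 0 < 1 / (2 * (C + L + 1)) := by positivity
  have hLδ : L * (1 / (2 * (C + L + 1))) ≤ 1 / 2 := by
    rw [mul_one_div, div_le_iff₀ (by positivity)]
    linarith
  have hCδ : C * (1 / (2 * (C + L + 1))) ≤ 1 := by
    rw [mul_one_div, div_le_iff₀ (by positivity)]
    linarith [L.2]
  refine ⟨_, hδ, fun a ha t₀ φ hφ => ?_⟩
  have hψ : schro (-a t₀) (toL2 φ) ∈ H2Ball d M := schro_mem_H2Ball _ (toL2_mem_H2Ball_iff.2 hφ)
  have hfield := continuousOn_interactionField hL.continuousOn ha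
  have hmaps : ∀ z : ℝ → L2Space d, Continuous z → (∀ t, z t ∈ H2Ball d (M + 1)) →
      ∀ t ∈ Icc t₀ (t₀ + 1 / (2 * (C + L + 1))), schro (-a t₀) (toL2 φ) +
        ∫ s in t₀..t, interactionField q a s (z s) ∈ H2Ball d (M + 1) := by
    intro z hz hzR t ht
    have hint := integral_mem_H2Ball ht.1
      ((hfield.comp_continuous (continuous_id.prodMk hz) fun s =>
        ⟨mem_univ s, hzR s⟩).intervalIntegrable _ _)
      fun s _ => mapsTo_interactionField hC s (hzR s)
    refine H2Ball_mono ?_ (add_mem_H2Ball hψ hint)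
    have hCt := mul_le_mul_of_nonneg_left (sub_le_iff_le_add'.2 ht.2) hC₀
    linarith
  obtain ⟨z, hz, hzR, hint⟩ := exists_integral_solution (isClosed_H2Ball d (M + 1))
    (H2Ball_mono (by linarith) hψ) (le_add_of_nonneg_right hδ.le)
    (by rwa [add_sub_cancel_left]) (lipschitzOnWith_interactionField hL) hfield hmaps
  exact exists_isMildOn_of_integral_solution ha hL.continuousOn hC hz hzR hint

namespace IsMildOn

variable {t₀ T : ℝ} {φ : H2Space d} {u v : ℝ → H2Space d}

theorem initial (hu : IsMildOn q a t₀ φ T u) (h : t₀ ≤ T) : u t₀ = φ := by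
  have hu₀ := hu.duhamel t₀ (left_mem_Icc.2 h)
  rw [intervalIntegral.integral_same, add_zero] at hu₀
  exact toL2_injective <| by rw [← schro_interaction a, hu₀, schro_schro_neg]

theorem congr (hu : IsMildOn q a t₀ φ T u) (h : EqOn v u (Icc t₀ T)) :
    IsMildOn q a t₀ φ T v := by
  have hinter : EqOn (interaction a v) (interaction a u) (Icc t₀ T) := fun t ht => by
    rw [interaction, h ht, interaction]
  refine ⟨hu.continuousOn.congr h, fun t ht => ?_⟩
  have hint : ∫ s in t₀..t, interactionField q a s (interaction a v s) =
      ∫ s in t₀..t, interactionField q a s (interaction a u s) := by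
    refine intervalIntegral.integral_congr fun s hs => ?_
    rw [uIcc_of_le ht.1] at hs
    exact congrArg (interactionField q a s) (hinter ⟨hs.1, hs.2.trans ht.2⟩)
  rw [hinter ht, hu.duhamel t ht, hint]

theorem hasDerivWithinAt (hd : d ≤ 3) (hq : 1 ≤ q) (ha : Continuous a)
    (hu : IsMildOn q a t₀ φ T u) {t : ℝ} (ht : t ∈ Icc t₀ T) :
    HasDerivWithinAt (interaction a u) (interactionField q a t (interaction a u t))
      (Icc t₀ T) t := by
  have hF := continuousOn_interactionField_interaction hd hq ha isCompact_Icc hu.continuousOn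
  have : Fact (t ∈ Icc t₀ T) := ⟨ht⟩
  have hint := intervalIntegral.integral_hasDerivWithinAt_right (s := Icc t₀ T)
    ((hF.mono (Icc_subset_Icc_right ht.2)).intervalIntegrable_of_Icc ht.1)
    (hF.stronglyMeasurableAtFilter_nhdsWithin measurableSet_Icc t) (hF t ht)
  exact (hint.const_add _).congr hu.duhamel (hu.duhamel t ht)

theorem eqOn (hd : d ≤ 3) (hq : 1 ≤ q) (ha : Continuous a) (hu : IsMildOn q a t₀ φ T u)
    (hv : IsMildOn q a t₀ φ T v) : EqOn u v (Icc t₀ T) := by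
  rcases lt_or_ge T t₀ with hT | hT
  · rw [Icc_eq_empty (not_le.2 hT)]
    exact eqOn_empty _ _
  obtain ⟨R, hR⟩ := isCompact_Icc.exists_bound_of_continuousOn hu.continuousOn
  obtain ⟨R', hR'⟩ := isCompact_Icc.exists_bound_of_continuousOn hv.continuousOn
  obtain ⟨L, hL⟩ := exists_lipschitzOnWith_nonlin hd hq (max R R')
  have hderiv : ∀ {w}, IsMildOn q a t₀ φ T w → ∀ t ∈ Ico t₀ T, HasDerivWithinAt
      (interaction a w) (interactionField q a t (interaction a w t)) (Ici t) t := fun hw t ht =>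
    (hw.hasDerivWithinAt hd hq ha (Ico_subset_Icc_self ht)).mono_of_mem_nhdsWithin
      (Icc_mem_nhdsGE_of_mem ht)
  have hinter : EqOn (interaction a u) (interaction a v) (Icc t₀ T) :=
    ODE_solution_unique_of_mem_Icc_right (fun t _ => lipschitzOnWith_interactionField hL t)
      (fun t ht => (hu.hasDerivWithinAt hd hq ha ht).continuousWithinAt) (hderiv hu)
      (fun t ht => interaction_mem_H2Ball
        ((hR t (Ico_subset_Icc_self ht)).trans (le_max_left _ _)))
      (fun t ht => (hv.hasDerivWithinAt hd hq ha ht).continuousWithinAt) (hderiv hv)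
      (fun t ht => interaction_mem_H2Ball
        ((hR' t (Ico_subset_Icc_self ht)).trans (le_max_right _ _)))
      (by rw [interaction, interaction, hu.initial hT, hv.initial hT])
  intro t ht
  exact toL2_injective <| by rw [← schro_interaction a, hinter ht, schro_interaction]

theorem glue {t₁ : ℝ} (hd : d ≤ 3) (hq : 1 ≤ q) (ha : Continuous a) (h₀₁ : t₀ ≤ t₁)
    (h₁ : t₁ ≤ T) (hu : IsMildOn q a t₀ φ t₁ u) (hv : IsMildOn q a t₁ (u t₁) T v) :
    ∃ w, IsMildOn q a t₀ φ T w := by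
  set w : ℝ → H2Space d := fun t => if t ≤ t₁ then u t else v t
  have hwu : EqOn w u (Icc t₀ t₁) := fun t ht => if_pos ht.2
  have hwv : EqOn w v (Icc t₁ T) := by
    intro t ht
    rcases ht.1.eq_or_lt with rfl | h
    · exact (if_pos le_rfl).trans (hv.initial h₁).symm
    · exact if_neg (not_le.2 h)
  have hu' := hu.congr hwu
  have hv' := hv.congr hwv
  have hwc : ContinuousOn w (Icc t₀ T) := by
    rw [← Icc_union_Icc_eq_Icc h₀₁ h₁]
    exact hu'.continuousOn.union_of_isClosed hv'.continuousOn isClosed_Icc isClosed_Icc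
  refine ⟨w, hwc, fun t ht => ?_⟩
  rcases le_total t t₁ with h | h
  · exact hu'.duhamel t ⟨ht.1, h⟩
  · have hF := continuousOn_interactionField_interaction hd hq ha isCompact_Icc hwc
    rw [hv'.duhamel t ⟨h, ht.2⟩, ← hwu (right_mem_Icc.2 h₀₁), ← interaction,
      hu'.duhamel t₁ (right_mem_Icc.2 h₀₁), add_assoc,
      intervalIntegral.integral_add_adjacent_intervals]
    · exact (hF.mono (Icc_subset_Icc_right h₁)).intervalIntegrable_of_Icc h₀₁
    · exact (hF.mono (Icc_subset_Icc h₀₁ ht.2)).intervalIntegrable_of_Icc h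

end IsMildOn

end Duhamel

section DispersionMap

theorem measurable_dispersionMap (γp γm tp : ℝ) : Measurable (dispersionMap γp γm tp) :=
  Measurable.ite ((measurableSet_lt measurable_const measurable_fract).inter
    (measurableSet_le measurable_fract measurable_const)) measurable_const measurable_const

theorem abs_dispersionMap_le (γp γm tp t : ℝ) :
    |dispersionMap γp γm tp t| ≤ max |γp| |γm| := by
  rw [dispersionMap]
  split_ifs
  · exact le_max_left _ _
  · exact (abs_neg γm).trans_le (le_max_right _ _)

theorem intervalIntegrable_dispersionMap (γp γm tp ε s t : ℝ) :
    IntervalIntegrable (fun r => dispersionMap γp γm tp (r / ε)) volume s t :=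
  (intervalIntegrable_const (c := max |γp| |γm|)).mono_fun
    ((measurable_dispersionMap γp γm tp).comp (measurable_id.div_const ε)).aestronglyMeasurable
    (Eventually.of_forall fun _ => (abs_dispersionMap_le _ _ _ _).trans (le_abs_self _))

/-- The accumulated dispersion `∫₀ᵗ γ(s/ε) ds`. -/
def cumulDispersion (γp γm tp ε t : ℝ) : ℝ := ∫ s in 0..t, dispersionMap γp γm tp (s / ε)

theorem continuous_cumulDispersion (γp γm tp ε : ℝ) : Continuous (cumulDispersion γp γm tp ε) :=
  intervalIntegral.continuous_primitive
    (fun s t => intervalIntegrable_dispersionMap γp γm tp ε s t) 0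

theorem hasDerivAt_cumulDispersion {γp γm tp ε t : ℝ}
    (ht : ContinuousAt (fun s => dispersionMap γp γm tp (s / ε)) t) :
    HasDerivAt (cumulDispersion γp γm tp ε) (dispersionMap γp γm tp (t / ε)) t :=
  intervalIntegral.integral_hasDerivAt_right (intervalIntegrable_dispersionMap γp γm tp ε 0 t)
    ((measurable_dispersionMap γp γm tp).comp
      (measurable_id.div_const ε)).stronglyMeasurable.stronglyMeasurableAtFilter ht

theorem continuousAt_dispersionMap {γp γm tp t : ℝ} (h₀ : Int.fract t ≠ 0)
    (h₁ : Int.fract t ≠ tp) : ContinuousAt (dispersionMap γp γm tp) t := by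
  have hfract : ContinuousAt Int.fract t :=
    continuousAt_fract fun h => h₀ (by rw [h, Int.fract_intCast])
  have hpos : ∀ᶠ s in 𝓝 t, 0 < Int.fract s :=
    hfract.eventually_const_lt ((Int.fract_nonneg t).lt_of_ne' h₀)
  rcases h₁.lt_or_gt with h | h
  · refine continuousAt_const.congr (f := fun _ => γp) ?_
    filter_upwards [hpos, hfract.eventually_lt_const h] with s hs hstp
    exact (if_pos ⟨hs, hstp.le⟩).symm
  · refine continuousAt_const.congr (f := fun _ => -γm) ?_
    filter_upwards [hfract.eventually_const_lt h] with s hs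
    exact (if_neg fun hstp => hs.not_ge hstp.2).symm

theorem countable_not_continuousAt_dispersionMap (γp γm tp : ℝ) {ε : ℝ} (hε : ε ≠ 0) :
    {t | ¬ContinuousAt (fun s => dispersionMap γp γm tp (s / ε)) t}.Countable := by
  have hcountable :
      ((range fun n : ℤ => (n + 0) * ε) ∪ range fun n : ℤ => (n + tp) * ε).Countable :=
    (countable_range _).union (countable_range _)
  have hmem : ∀ {t c : ℝ}, Int.fract (t / ε) = c → t ∈ range fun n : ℤ => (n + c) * ε := by
    rintro t _ rfl
    exact ⟨⌊t / ε⌋, by simp only [Int.floor_add_fract, div_mul_cancel₀ _ hε]⟩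
  refine hcountable.mono fun t ht => ?_
  contrapose! ht
  rw [mem_union, not_or] at ht
  exact not_not.2 <| (continuousAt_dispersionMap (fun h => ht.1 (hmem h))
    fun h => ht.2 (hmem h)).comp (f := fun s => s / ε) (continuousAt_id.div_const ε)

end DispersionMap

theorem equation_iff {d : ℕ} (hd : d ≤ 3) {p : ℝ} (hp : 1 ≤ p) (γ : ℝ) (f : H2Space d)
    (f' : L2Space d) :
    (∀ᵐ x, Complex.I * f' x + (γ : ℂ) * laplace f x +
      ((‖toL2 f x‖ ^ (p - 1) : ℝ) : ℂ) * toL2 f x = 0) ↔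
    f' = Complex.I • nonlin (p - 1) (toL2 f) + (γ : ℂ) • Complex.I • laplace f := by
  obtain ⟨C, -, hC⟩ := exists_ae_norm_toL2_le hd
  have hrhs : (Complex.I • nonlin (p - 1) (toL2 f) + (γ : ℂ) • Complex.I • laplace f : L2Space d)
      =ᵐ[volume] fun x => Complex.I * (((‖toL2 f x‖ ^ (p - 1) : ℝ) : ℂ) * toL2 f x) +
        (γ : ℂ) * (Complex.I * laplace f x) := by
    filter_upwards [coeFn_nonlin (sub_nonneg.2 hp) (hC f),
      Lp.coeFn_add (Complex.I • nonlin (p - 1) (toL2 f)) ((γ : ℂ) • Complex.I • laplace f),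
      Lp.coeFn_smul Complex.I (nonlin (p - 1) (toL2 f)),
      Lp.coeFn_smul (γ : ℂ) (Complex.I • laplace f), Lp.coeFn_smul Complex.I (laplace f)]
      with x hnonlin hadd hI hγ hI'
    rw [hadd, Pi.add_apply, hI, Pi.smul_apply, hnonlin, hγ, Pi.smul_apply, hI', Pi.smul_apply,
      powNL, Complex.real_smul, smul_eq_mul, smul_eq_mul, smul_eq_mul]
  constructor
  · intro h
    refine Lp.ext ?_
    filter_upwards [h, hrhs] with x hx hrhs_x
    rw [hrhs_x]
    linear_combination -Complex.I * hx + f' x * Complex.I_mul_I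
  · rintro rfl
    filter_upwards [hrhs] with x hrhs_x
    rw [hrhs_x]
    linear_combination (((‖toL2 f x‖ ^ (p - 1) : ℝ) : ℂ) * toL2 f x + (γ : ℂ) * laplace f x) *
      Complex.I_mul_I

section Maximal

variable {d : ℕ} {p γp γm tp ε t₀ T : ℝ} {φ : H2Space d} {u v : ℝ → H2Space d}

theorem IsSolutionOn.hasDerivAt_interaction (hd : d ≤ 3) (hp : 1 ≤ p)
    (hu : IsSolutionOn p γp γm tp ε t₀ φ T u) {t : ℝ} (ht : t ∈ Ioo t₀ T)
    (hγ : ContinuousAt (fun s => dispersionMap γp γm tp (s / ε)) t) :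
    HasDerivAt (interaction (cumulDispersion γp γm tp ε) u)
      (interactionField (p - 1) (cumulDispersion γp γm tp ε) t
        (interaction (cumulDispersion γp γm tp ε) u t)) t := by
  obtain ⟨u', hu', heq⟩ := hu.equation t ht hγ
  rw [equation_iff hd hp] at heq
  refine (hasDerivAt_schro_comp (hasDerivAt_cumulDispersion hγ).neg hu' rfl).congr_deriv ?_
  rw [interactionField, schro_interaction, heq]
  simp only [map_add, map_smul, Complex.ofReal_neg, neg_smul, add_neg_cancel_right,
    Pi.neg_apply]

theorem IsSolutionOn.isMildOn (hd : d ≤ 3) (hp : 2 ≤ p) (hε : ε ≠ 0)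
    (hu : IsSolutionOn p γp γm tp ε t₀ φ T u) :
    IsMildOn (p - 1) (cumulDispersion γp γm tp ε) t₀ φ T u := by
  have ha := continuous_cumulDispersion γp γm tp ε
  refine ⟨hu.continuousOn, fun t ht => ?_⟩
  have hut := hu.continuousOn.mono (Icc_subset_Icc_right ht.2)
  have hint := integral_eq_of_hasDerivAt_off_countable_of_le _ _ ht.1
    (countable_not_continuousAt_dispersionMap γp γm tp hε) (continuousOn_interaction ha hut)
    (fun s hs => hu.hasDerivAt_interaction hd (by linarith) ⟨hs.1.1, hs.1.2.trans_le ht.2⟩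
      (not_not.1 hs.2))
    ((continuousOn_interactionField_interaction hd (by linarith) ha isCompact_Icc
      hut).intervalIntegrable_of_Icc ht.1)
  rw [hint, interaction, interaction, hu.initial, add_sub_cancel]

theorem IsMildOn.isSolutionOn (hd : d ≤ 3) (hp : 2 ≤ p) (hT : t₀ ≤ T)
    (hu : IsMildOn (p - 1) (cumulDispersion γp γm tp ε) t₀ φ T u) :
    IsSolutionOn p γp γm tp ε t₀ φ T u := by
  set a := cumulDispersion γp γm tp ε
  refine ⟨hu.continuousOn, hu.initial hT, fun t ht hγ =>
    ⟨_, ?_, (equation_iff hd (by linarith) _ _ _).2 rfl⟩⟩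
  have hinter := (hu.hasDerivWithinAt hd (by linarith) (continuous_cumulDispersion γp γm tp ε)
    (Ioo_subset_Icc_self ht)).hasDerivAt (Icc_mem_nhds ht.1 ht.2)
  have hderiv := hasDerivAt_schro_comp (hasDerivAt_cumulDispersion hγ) hinter
    (toL2_schroH2 (-a t) (u t)).symm
  simp_rw [show cumulDispersion γp γm tp ε = a from rfl, schro_interaction] at hderiv
  refine hderiv.congr_deriv ?_
  rw [interactionField, schro_interaction, map_smul, schro_schro_neg, laplace_schroH2,
    schro_schro_neg]

theorem IsSolutionOn.mono {T' : ℝ} (hu : IsSolutionOn p γp γm tp ε t₀ φ T u) (h : T' ≤ T) :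
    IsSolutionOn p γp γm tp ε t₀ φ T' u :=
  ⟨hu.continuousOn.mono (Icc_subset_Icc_right h), hu.initial,
    fun t ht => hu.equation t ⟨ht.1, ht.2.trans_le h⟩⟩

theorem IsSolutionOn.congr (hT : t₀ ≤ T) (hu : IsSolutionOn p γp γm tp ε t₀ φ T u)
    (h : EqOn v u (Icc t₀ T)) : IsSolutionOn p γp γm tp ε t₀ φ T v := by
  refine ⟨hu.continuousOn.congr h, (h (left_mem_Icc.2 hT)).trans hu.initial, fun t ht hγ => ?_⟩
  obtain ⟨u', hu', heq⟩ := hu.equation t ht hγ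
  refine ⟨u', hu'.congr_of_eventuallyEq ?_, by rwa [h (Ioo_subset_Icc_self ht)]⟩
  filter_upwards [Ioo_mem_nhds ht.1 ht.2] with s hs
  rw [h (Ioo_subset_Icc_self hs)]

theorem IsSolutionOn.eqOn (hd : d ≤ 3) (hp : 2 ≤ p) (hε : ε ≠ 0)
    (hu : IsSolutionOn p γp γm tp ε t₀ φ T u) (hv : IsSolutionOn p γp γm tp ε t₀ φ T v) :
    EqOn u v (Icc t₀ T) :=
  (hu.isMildOn hd hp hε).eqOn hd (by linarith) (continuous_cumulDispersion γp γm tp ε)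
    (hv.isMildOn hd hp hε)

theorem IsSolutionOn.le_maxTime (hT : t₀ < T) (hu : IsSolutionOn p γp γm tp ε t₀ φ T u) :
    (T : EReal) ≤ maxTime p γp γm tp ε t₀ φ :=
  le_sSup ⟨T, rfl, hT, u, hu⟩

theorem exists_isSolutionOn_of_lt_maxTime (hT : (T : EReal) < maxTime p γp γm tp ε t₀ φ) :
    ∃ v, IsSolutionOn p γp γm tp ε t₀ φ T v := by
  obtain ⟨_, ⟨T', rfl, -, v, hv⟩, hlt⟩ := lt_sSup_iff.1 hT
  exact ⟨v, hv.mono (EReal.coe_lt_coe_iff.1 hlt).le⟩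

theorem exists_add_le_maxTime (hd : d ≤ 3) (hp : 2 ≤ p) (M : ℝ) :
    ∃ δ > 0, ∀ (γp γm tp ε t₀ : ℝ) (φ : H2Space d), ‖φ‖ ≤ M →
      ((t₀ + δ : ℝ) : EReal) ≤ maxTime p γp γm tp ε t₀ φ := by
  obtain ⟨δ, hδ, hexists⟩ := exists_isMildOn (d := d) (q := p - 1) hd (by linarith) M
  refine ⟨δ, hδ, fun γp γm tp ε t₀ φ hφ => ?_⟩
  obtain ⟨u, hu⟩ := hexists _ (continuous_cumulDispersion γp γm tp ε) t₀ φ hφ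
  exact (hu.isSolutionOn hd hp (by linarith)).le_maxTime (by linarith)

theorem lt_maxTime (hd : d ≤ 3) (hp : 2 ≤ p) (γp γm tp ε t₀ : ℝ) (φ : H2Space d) :
    (t₀ : EReal) < maxTime p γp γm tp ε t₀ φ := by
  obtain ⟨δ, hδ, hle⟩ := exists_add_le_maxTime hd hp ‖φ‖
  exact (EReal.coe_lt_coe_iff.2 (by linarith)).trans_le (hle γp γm tp ε t₀ φ le_rfl)

theorem exists_isSolutionOn_forall_lt_maxTime (hd : d ≤ 3) (hp : 2 ≤ p) (γp γm tp : ℝ)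
    (hε : ε ≠ 0) (t₀ : ℝ) (φ : H2Space d) :
    ∃ u : ℝ → H2Space d, ∀ T : ℝ, t₀ < T → (T : EReal) < maxTime p γp γm tp ε t₀ φ →
      IsSolutionOn p γp γm tp ε t₀ φ T u := by
  choose! v hv using fun T : ℝ => exists_isSolutionOn_of_lt_maxTime (p := p) (γp := γp)
    (γm := γm) (tp := tp) (ε := ε) (t₀ := t₀) (φ := φ) (T := T)
  refine ⟨fun t => v t t, fun T hT hTmax => (hv T hTmax).congr hT.le fun t ht => ?_⟩
  have htmax : (t : EReal) < maxTime p γp γm tp ε t₀ φ :=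
    (EReal.coe_le_coe_iff.2 ht.2).trans_lt hTmax
  exact (hv t htmax).eqOn hd hp hε ((hv T hTmax).mono ht.2) (right_mem_Icc.2 ht.1)

theorem tendsto_norm_atTop_of_maxTime_eq (hd : d ≤ 3) (hp : 2 ≤ p) (hε : ε ≠ 0) {Tmax : ℝ}
    (hTmax : maxTime p γp γm tp ε t₀ φ = Tmax)
    (hu : ∀ T : ℝ, t₀ < T → (T : EReal) < maxTime p γp γm tp ε t₀ φ →
      IsSolutionOn p γp γm tp ε t₀ φ T u) :
    Tendsto (fun t => ‖u t‖) (𝓝[<] Tmax) atTop := by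
  have ha := continuous_cumulDispersion γp γm tp ε
  have ht₀ : t₀ < Tmax := by
    rw [← EReal.coe_lt_coe_iff, ← hTmax]
    exact lt_maxTime hd hp γp γm tp ε t₀ φ
  refine tendsto_atTop.2 fun M => ?_
  obtain ⟨δ, hδ, hexists⟩ := exists_isMildOn (d := d) (q := p - 1) hd (by linarith) M
  filter_upwards [Ioo_mem_nhdsLT ht₀, Ioo_mem_nhdsLT (sub_lt_self Tmax hδ)] with t ht htδ
  by_contra! hM
  -- A norm at most `M` at time `t` would let the solution be continued beyond `Tmax < t + δ`.
  obtain ⟨v, hv⟩ := hexists _ ha t (u t) hM.le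
  have hut := hu t ht.1 (by rw [hTmax]; exact EReal.coe_lt_coe_iff.2 ht.2)
  obtain ⟨w, hw⟩ := (hut.isMildOn hd hp hε).glue hd (by linarith) ha ht.1.le (by linarith) hv
  have hle := (hw.isSolutionOn hd hp (by linarith [ht.1])).le_maxTime (by linarith [ht.1])
  rw [hTmax, EReal.coe_le_coe_iff] at hle
  linarith [htδ.1]

end Maximal

end DispersionNLS

end

theorem lemma4p2_general {d : ℕ} (hd : d ≤ 3) {p : ℝ} (hp : 2 ≤ p) :
    (∀ γp γm tp ε : ℝ, ε ≠ 0 → ∀ (t₀ : ℝ) (φ : DispersionNLS.H2Space d),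
      (t₀ : EReal) < DispersionNLS.maxTime p γp γm tp ε t₀ φ ∧
      ∃ u : ℝ → DispersionNLS.H2Space d,
        (∀ T : ℝ, t₀ < T → (T : EReal) < DispersionNLS.maxTime p γp γm tp ε t₀ φ →
          DispersionNLS.IsSolutionOn p γp γm tp ε t₀ φ T u ∧
          ∀ v : ℝ → DispersionNLS.H2Space d,
            DispersionNLS.IsSolutionOn p γp γm tp ε t₀ φ T v → EqOn v u (Icc t₀ T)) ∧
        (∀ Tmax : ℝ, DispersionNLS.maxTime p γp γm tp ε t₀ φ = (Tmax : EReal) →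
          Tendsto (fun t => ‖u t‖) (𝓝[<] Tmax) atTop)) ∧
    (∀ M : ℝ, ∃ δ : ℝ, 0 < δ ∧ ∀ γp γm tp ε : ℝ, ε ≠ 0 →
      ∀ (t₀ : ℝ) (φ : DispersionNLS.H2Space d), ‖φ‖ ≤ M →
        ((t₀ + δ : ℝ) : EReal) ≤ DispersionNLS.maxTime p γp γm tp ε t₀ φ) := by
  refine ⟨fun γp γm tp ε hε t₀ φ => ⟨DispersionNLS.lt_maxTime hd hp γp γm tp ε t₀ φ, ?_⟩,
    fun M => ?_⟩
  · obtain ⟨u, hu⟩ := DispersionNLS.exists_isSolutionOn_forall_lt_maxTime hd hp γp γm tp hε t₀ φ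
    exact ⟨u, fun T hT hTmax => ⟨hu T hT hTmax, fun v hv => hv.eqOn hd hp hε (hu T hT hTmax)⟩,
      fun Tmax hTmax => DispersionNLS.tendsto_norm_atTop_of_maxTime_eq hd hp hε hTmax hu⟩
  · obtain ⟨δ, hδ, hle⟩ := DispersionNLS.exists_add_le_maxTime (d := d) hd hp M
    exact ⟨δ, hδ, fun γp γm tp ε _ => hle γp γm tp ε⟩

theorem lemma4p2 (d : ℕ) (hd : 1 ≤ d) (hd3 : d ≤ 3) (p : ℝ) (hp : 2 ≤ p)
    (γp γm tp : ℝ) (hγp : 0 < γp) (hγm : 0 < γm) (htp0 : 0 < tp) (htp1 : tp < 1) :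
    -- for each `ε`, `t₀`, `φ`: the maximal solution, its uniqueness, the blow-up alternative
    (∀ ε : ℝ, 0 < ε → ∀ (t₀ : ℝ) (φ : DispersionNLS.H2Space d),
      (t₀ : EReal) < DispersionNLS.maxTime p γp γm tp ε t₀ φ ∧
      ∃ u : ℝ → DispersionNLS.H2Space d,
        (∀ T : ℝ, t₀ < T → (T : EReal) < DispersionNLS.maxTime p γp γm tp ε t₀ φ →
          DispersionNLS.IsSolutionOn p γp γm tp ε t₀ φ T u ∧
          ∀ v : ℝ → DispersionNLS.H2Space d,
            DispersionNLS.IsSolutionOn p γp γm tp ε t₀ φ T v → EqOn v u (Icc t₀ T)) ∧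
        (∀ Tmax : ℝ, DispersionNLS.maxTime p γp γm tp ε t₀ φ = (Tmax : EReal) →
          Tendsto (fun t => ‖u t‖) (𝓝[<] Tmax) atTop)) ∧
    -- for each `ε`, the existence time is bounded below in terms of the norm of the datum
    (∀ ε : ℝ, 0 < ε → ∀ M : ℝ, ∃ δ : ℝ, 0 < δ ∧
      ∀ (t₀ : ℝ) (φ : DispersionNLS.H2Space d), ‖φ‖ ≤ M →
        ((t₀ + δ : ℝ) : EReal) ≤ DispersionNLS.maxTime p γp γm tp ε t₀ φ) ∧
    -- and this bound is uniform for `0 < ε ≤ 1`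
    (∀ M : ℝ, ∃ δ : ℝ, 0 < δ ∧ ∀ ε : ℝ, 0 < ε → ε ≤ 1 →
      ∀ (t₀ : ℝ) (φ : DispersionNLS.H2Space d), ‖φ‖ ≤ M →
        ((t₀ + δ : ℝ) : EReal) ≤ DispersionNLS.maxTime p γp γm tp ε t₀ φ) := by
  obtain ⟨hmax, hbound⟩ := lemma4p2_general hd3 hp
  refine ⟨fun ε hε => hmax γp γm tp ε hε.ne', fun ε hε M => ?_, fun M => ?_⟩
  · exact (hbound M).imp fun δ hδ => ⟨hδ.1, hδ.2 γp γm tp ε hε.ne'⟩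
  · exact (hbound M).imp fun δ hδ => ⟨hδ.1, fun ε hε _ => hδ.2 γp γm tp ε hε.ne'⟩
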